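/- Let $M$ be a connected (Hausdorff) smooth manifold of finite dimension $n$, let $\nabla$ be a smooth symmetric (torsion-free) linear connection on $M$, and let $\hbar$ be a nonzero real number. Let $C^\infty(M)$ be the algebra of smooth complex-valued functions on $M$ and, for $x\in M$, let $\mathfrak m_x\subset C^\infty(M)$ be the ideal of functions vanishing at $x$. A linear differential operator on $C^\infty(M)$ is a $\mathbb C$-linear map $P\colon C^\infty(M)\to C^\infty(M)$ for which there is an $r\ge 0$ with $P(\mathfrak m_x^{r+1})\subseteq\mathfrak m_x$ for all $x\in M$. For a smooth symmetric contravariant tensor field $\Phi=\Phi_r+\cdots+\Phi_0$ on $M$ with complex coefficients ($\Phi_k$ homogeneous of order $k$), an operator $P$ is called the quantized of $\Phi$ if $$P f=\sum_{k=0}^r(-i\hbar)^k\langle\Phi_k,\nabla^k_{\mathrm{sym}}f\rangle\qquad\text{for all } f\in C^\infty(M),$$ where $\nabla^k_{\mathrm{sym}}f$ is the symmetrization of the $k$-th iterated covariant differential of $f$ and $\langle\,,\,\rangle$ is tensor contraction. The function on $T^*M$ corresponding to $\Phi$ is $F_\Phi(p)=\sum_k\Phi_k(p,\dots,p)$. Let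 $\theta$ be the Liouville form of $T^*M$ and $\omega_2=d\theta$ its canonical symplectic form; the Hamiltonian field of a smooth function $F\colon T^*M\to\mathbb C$ is the (complex) vector field $D_F$ on $T^*M$ with $D_F\lrcorner\,\omega_2+dF=0$. Then: 1. Every linear differential operator $P$ on $C^\infty(M)$ is the quantized of exactly one symmetric contravariant tensor field $\Phi$ (not necessarily homogeneous). The function $F_\Phi$ is called the Hamiltonian of $P$, and $D_P:=D_{F_\Phi}$ the Hamiltonian field associated with $P$. 2. The assignment $P\mapsto D_P$ induces a bijection between the linear differential operators on $C^\infty(M)$, taken modulo the addition of operators $f\mapsto cf$ with $c\in\mathbb C$ constant, and the infinitesimal canonical transformations of $T^*M$ that correspond to functions polynomial along the fibres, i.e. the Hamiltonian fields $D_F$ of the smooth functions $F\colon T^*M\to\mathbb C$ for which there is a $d\ge 0$ such that $F$ restricted to each fibre $T^*_xM$ is a polynomial function of degree at most $d$. -/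

import Mathlib

set_option maxSynthPendingDepth 3

open scoped Manifold ContDiff Bundle TensorProduct

noncomputable section

namespace Quantization

variable (n : ℕ) (M : Type*) [TopologicalSpace M] [ChartedSpace (EuclideanSpace ℝ (Fin n)) M]

/-! ### Smooth complex functions and linear differential operators -/

/-- The `ℂ`-algebra `C^∞(M)` of smooth complex valued functions on `M`. -/
def smoothFunctions : Subalgebra ℂ (M → ℂ) where
  carrier := {f | ContMDiff (𝓡 n) 𝓘(ℝ, ℂ) ∞ f}
  mul_mem' {f g} hf hg := by
    have h : ContDiff ℝ ∞ (fun z : ℂ × ℂ => z.1 * z.2) := contDiff_fst.mul contDiff_snd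
    exact h.contMDiff.comp (hf.prodMk_space hg)
  add_mem' {f g} hf hg := by
    have h : ContDiff ℝ ∞ (fun z : ℂ × ℂ => z.1 + z.2) := contDiff_fst.add contDiff_snd
    exact h.contMDiff.comp (hf.prodMk_space hg)
  algebraMap_mem' c := contMDiff_const

/-- The type of smooth complex valued functions on `M`. -/
def SmoothFun : Type _ := smoothFunctions n M

instance : CommRing (SmoothFun n M) := inferInstanceAs (CommRing (smoothFunctions n M))

instance : Algebra ℂ (SmoothFun n M) := inferInstanceAs (Algebra ℂ (smoothFunctions n M))

instance : CoeFun (SmoothFun n M) (fun _ => M → ℂ) := ⟨fun f => Subtype.val f⟩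

variable {n M} in
theorem SmoothFun.zero_apply (x : M) : (0 : SmoothFun n M) x = 0 := rfl

variable {n M} in
theorem SmoothFun.add_apply (f g : SmoothFun n M) (x : M) : (f + g) x = f x + g x := rfl

variable {n M} in
theorem SmoothFun.mul_apply (f g : SmoothFun n M) (x : M) : (f * g) x = f x * g x := rfl

variable {n M} in
theorem SmoothFun.smul_apply (c : ℂ) (f : SmoothFun n M) (x : M) : (c • f) x = c * f x := rfl

variable {M} in
/-- The ideal `𝔪_x` of the smooth functions that vanish at `x`. -/
def vanishingIdeal (x : M) : Ideal (SmoothFun n M) where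
  carrier := {f | f x = 0}
  zero_mem' := rfl
  add_mem' {f g} hf hg := by
    have hf' : f x = 0 := hf
    have hg' : g x = 0 := hg
    show (f + g) x = 0
    rw [SmoothFun.add_apply, hf', hg', add_zero]
  smul_mem' c f hf := by
    have hf' : f x = 0 := hf
    show (c * f) x = 0
    rw [SmoothFun.mul_apply, hf', mul_zero]

/-- The linear differential operators on `C^∞(M)`: the `ℂ`-linear maps `P` such that, for some
order `r`, `P` maps `𝔪_x ^ (r + 1)` into `𝔪_x` for all points `x`. -/
def diffOp : Submodule ℂ (SmoothFun n M →ₗ[ℂ] SmoothFun n M) where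
  carrier := {P | ∃ r : ℕ, ∀ x : M, ∀ f ∈ vanishingIdeal n x ^ (r + 1), P f ∈ vanishingIdeal n x}
  zero_mem' := ⟨0, fun x _ _ => (vanishingIdeal n x).zero_mem⟩
  add_mem' := by
    rintro P Q ⟨r, hr⟩ ⟨s, hs⟩
    refine ⟨max r s, fun x f hf => (vanishingIdeal n x).add_mem (hr x f ?_) (hs x f ?_)⟩
    · exact Ideal.pow_le_pow_right (by omega) hf
    · exact Ideal.pow_le_pow_right (by omega) hf
  smul_mem' := by
    rintro c P ⟨r, hr⟩
    refine ⟨r, fun x f hf => ?_⟩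
    have h : P f x = 0 := hr x f hf
    show (c • P f) x = 0
    rw [SmoothFun.smul_apply, h, mul_zero]

/-- The operators `f ↦ c f` with `c` a complex constant, among the differential operators. -/
def constantOp : Submodule ℂ (diffOp n M) :=
  (Submodule.span ℂ {(LinearMap.id : SmoothFun n M →ₗ[ℂ] SmoothFun n M)}).submoduleOf (diffOp n M)

/-! ### The cotangent bundle and symmetric contravariant tensor fields -/

/-- The cotangent space `T_x^*M`, as fibre of Mathlib's bundle of homomorphisms from the tangent
bundle to the trivial line bundle. -/
abbrev Cotangent (x : M) : Type := TangentSpace (𝓡 n) x →L[ℝ] Bundle.Trivial M ℝ x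

/-- The cotangent bundle `T^*M`, a smooth manifold modelled on `ℝⁿ × (ℝⁿ)^*`. -/
abbrev CotangentBundle : Type _ :=
  Bundle.TotalSpace (EuclideanSpace ℝ (Fin n) →L[ℝ] ℝ) (Cotangent n M)

/-- The model space of `T^*M`. -/
abbrev CotangentModel : Type := EuclideanSpace ℝ (Fin n) × (EuclideanSpace ℝ (Fin n) →L[ℝ] ℝ)

/-- The model with corners of `T^*M`. -/
abbrev cotangentModel := (𝓡 n).prod 𝓘(ℝ, EuclideanSpace ℝ (Fin n) →L[ℝ] ℝ)

/-- The differential at `x` of a real function on `M`, as an element of `T_x^*M`. -/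
def differential {M : Type*} [TopologicalSpace M] [ChartedSpace (EuclideanSpace ℝ (Fin n)) M]
    (f : M → ℝ) (x : M) : Cotangent n M x :=
  mvfderiv (𝓡 n) f x

/-- Homogeneous symmetric contravariant tensor fields of order `r` on `M`, smooth and with complex
coefficients. The value at `x` is a symmetric `r`-linear map `T_x^*M × ⋯ × T_x^*M → ℂ`, that is, an
element of `ℂ ⊗ Sym^r(T_xM)`. Since the differentials of global smooth functions
provide local coframes, the last condition says that the components in charts are smooth. -/
def symTensor (r : ℕ) :
    Submodule ℂ (∀ x : M, MultilinearMap ℝ (fun _ : Fin r => Cotangent n M x) ℂ) where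
  carrier := {Φ |
    (∀ (x : M) (σ : Equiv.Perm (Fin r)) (ξ : Fin r → Cotangent n M x),
      Φ x (fun i => ξ (σ i)) = Φ x ξ) ∧
    ∀ f : Fin r → M → ℝ, (∀ i, ContMDiff (𝓡 n) 𝓘(ℝ, ℝ) ∞ (f i)) →
      ContMDiff (𝓡 n) 𝓘(ℝ, ℂ) ∞ (fun x => Φ x (fun i => differential n (f i) x))}
  zero_mem' := ⟨fun _ _ _ => rfl, fun _ _ => contMDiff_const⟩
  add_mem' := by
    rintro Φ Ψ ⟨h1, h2⟩ ⟨h3, h4⟩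
    exact ⟨fun x σ ξ => congrArg₂ (· + ·) (h1 x σ ξ) (h3 x σ ξ),
      fun f hf => (smoothFunctions n M).add_mem (h2 f hf) (h4 f hf)⟩
  smul_mem' := by
    rintro c Φ ⟨h1, h2⟩
    exact ⟨fun x σ ξ => congrArg (c • ·) (h1 x σ ξ),
      fun f hf => (smoothFunctions n M).smul_mem (h2 f hf) c⟩

/-- Symmetric contravariant tensor fields on `M`, not necessarily homogeneous: finite sums
`Φ = Φ_r + ⋯ + Φ_0` of homogeneous ones. -/
abbrev SymTensor : Type _ := Π₀ r : ℕ, symTensor n M r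

open Classical in
/-- The function on `T^*M` that corresponds to the tensor field `Φ`; its value at `p ∈ T_x^*M` is
`∑ r, Φ_r(p, …, p)`. -/
def fibreFunction {n : ℕ} {M : Type*} [TopologicalSpace M]
    [ChartedSpace (EuclideanSpace ℝ (Fin n)) M] (Φ : SymTensor n M) (p : CotangentBundle n M) : ℂ :=
  ∑ r ∈ Φ.support, (Φ r).1 p.proj (fun _ => p.2)

/-! ### Quantization by a linear connection -/

section Connection

variable {n} {M} [IsManifold (𝓡 n) ∞ M]

variable (n M) in
/-- Linear connections on `M`. -/
abbrev LinearConnection : Type _ :=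
  CovariantDerivative (𝓡 n) (EuclideanSpace ℝ (Fin n)) (TangentSpace (𝓡 n) : M → Type)

/-- The iterated covariant differential of a complex function, evaluated on vector fields:
`∇⁰f = f` and
`(∇^{r+1}f)(X₀, X₁, …, X_r) = X₀((∇^r f)(X₁, …, X_r)) - ∑ j, (∇^r f)(X₁, …, ∇_{X₀}X_j, …, X_r)`. -/
def iteratedCov (cov : LinearConnection n M) (f : M → ℂ) :
    (r : ℕ) → (Fin r → ∀ x : M, TangentSpace (𝓡 n) x) → M → ℂ
  | 0, _, x => f x
  | r + 1, X, x =>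
      mvfderiv (𝓡 n) (iteratedCov cov f r (Fin.tail X)) x (X 0 x) -
        ∑ j : Fin r, iteratedCov cov f r
          (Function.update (Fin.tail X) j (fun y => cov (X j.succ) y (X 0 y))) x

/-- The covariant tensor `∇^r f` at `x`, evaluated on tangent vectors at `x`, which are extended to
vector fields that are smooth near `x`. -/
def iteratedCovAt (cov : LinearConnection n M)
    (f : M → ℂ) (r : ℕ) (x : M) (v : Fin r → TangentSpace (𝓡 n) x) : ℂ :=
  iteratedCov cov f r (fun i => FiberBundle.extend (EuclideanSpace ℝ (Fin n)) (v i)) x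

/-- The symmetrized tensor `∇^r_sym f` at `x`. -/
def symCovAt (cov : LinearConnection n M)
    (f : M → ℂ) (r : ℕ) (x : M) (v : Fin r → TangentSpace (𝓡 n) x) : ℂ :=
  (r.factorial : ℂ)⁻¹ * ∑ σ : Equiv.Perm (Fin r), iteratedCovAt cov f r x (fun i => v (σ i))

/-- The standard basis of the model space `ℝⁿ` as a basis of the tangent space `T_xM`. -/
def tangentBasis (x : M) : Module.Basis (Fin n) ℝ (TangentSpace (𝓡 n) x) :=
  (EuclideanSpace.basisFun (Fin n) ℝ).toBasis

/-- The basis of `T_x^*M` dual to `tangentBasis x`. -/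
def dualBasis (x : M) (i : Fin n) : Cotangent n M x :=
  LinearMap.toContinuousLinearMap (𝕜 := ℝ) (E := EuclideanSpace ℝ (Fin n)) (F' := ℝ)
    ((tangentBasis x).coord i)

/-- The contraction `⟨A, B⟩ = ∑ A^{i₁ ⋯ i_r} B_{i₁ ⋯ i_r}` of a contravariant tensor `A` with a
covariant tensor `B` at the point `x`; it does not depend on the basis of `T_xM`. -/
def contraction {r : ℕ} {x : M} (A : MultilinearMap ℝ (fun _ : Fin r => Cotangent n M x) ℂ)
    (B : (Fin r → TangentSpace (𝓡 n) x) → ℂ) : ℂ :=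
  ∑ i : Fin r → Fin n, A (fun k => dualBasis x (i k)) * B (fun k => tangentBasis x (i k))

open Classical in
/-- `P` is the quantized `Φ̂` of the tensor field `Φ`:
`P f = ∑ r, (-iħ)^r ⟨Φ_r, ∇^r_sym f⟩` for all smooth `f`. -/
def IsQuantized (ħ : ℝ) (cov : LinearConnection n M)
    (Φ : SymTensor n M) (P : SmoothFun n M →ₗ[ℂ] SmoothFun n M) : Prop :=
  ∀ (f : SmoothFun n M) (x : M),
    P f x =
      ∑ r ∈ Φ.support, (-Complex.I * ħ) ^ r * contraction ((Φ r).1 x) (symCovAt cov f r x)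

end Connection

/-! ### The symplectic structure of the cotangent bundle -/

section Symplectic

variable {n} {M} [IsManifold (𝓡 n) ∞ M]

/-- The exterior derivative of a `1`-form `η` on a manifold without boundary,
`dη(v, w) = ∂_v(η(w)) - ∂_w(η(v))` in the preferred chart at the point `y`. -/
def extDerivOneForm {E H N : Type*} [NormedAddCommGroup E] [NormedSpace ℝ E] [TopologicalSpace H]
    (J : ModelWithCorners ℝ E H) [TopologicalSpace N] [ChartedSpace H N]
    (η : ∀ y : N, TangentSpace J y →L[ℝ] ℝ) (y : N) :
    TangentSpace J y →ₗ[ℝ] TangentSpace J y →ₗ[ℝ] ℝ :=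
  let localForm : E → (E →L[ℝ] ℝ) := fun z =>
    (η ((extChartAt J y).symm z)).comp (mfderiv 𝓘(ℝ, E) J (extChartAt J y).symm z)
  let A : E →L[ℝ] E →L[ℝ] ℝ := fderiv ℝ localForm (extChartAt J y y)
  let φ : TangentSpace J y →ₗ[ℝ] E := (mfderiv J 𝓘(ℝ, E) (extChartAt J y) y).toLinearMap
  LinearMap.mk₂ ℝ (fun v w => A (φ v) (φ w) - A (φ w) (φ v))
    (fun _ _ _ => by simp; ring) (fun _ _ _ => by simp; ring)
    (fun _ _ _ => by simp; ring) (fun _ _ _ => by simp; ring)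

/-- The Liouville form `θ` of `T^*M`, `θ_p(w) = p(π_* w)`. -/
def liouville (p : CotangentBundle n M) : TangentSpace (cotangentModel n) p →L[ℝ] ℝ :=
  ContinuousLinearMap.comp (p.2 : TangentSpace (𝓡 n) p.proj →L[ℝ] ℝ)
    (mfderiv (cotangentModel n) (𝓡 n)
      (Bundle.TotalSpace.proj : CotangentBundle n M → M) p)

/-- The canonical symplectic form `ω₂ = dθ` of `T^*M`. -/
def symplecticForm (p : CotangentBundle n M) :
    TangentSpace (cotangentModel n) p →ₗ[ℝ] TangentSpace (cotangentModel n) p →ₗ[ℝ] ℝ :=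
  extDerivOneForm (cotangentModel n) liouville p

variable (n M) in
/-- Complex tangent vector fields on `T^*M`: sections of `ℂ ⊗ T(T^*M)`. -/
abbrev ComplexField : Type _ :=
  ∀ p : CotangentBundle n M, ℂ ⊗[ℝ] TangentSpace (cotangentModel n) p

/-- The interior product `D ⌟ ω₂`, evaluated on the tangent vector `w` at `p`; it is the complex
linear extension of `v ↦ ω₂(v, w)` to `v ∈ ℂ ⊗ T_p(T^*M)`. -/
def interior (D : ComplexField n M) (p : CotangentBundle n M)
    (w : TangentSpace (cotangentModel n) p) : ℂ :=
  TensorProduct.rid ℝ ℂ (((symplecticForm p).flip w).baseChange ℂ (D p))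

/-- `D` is the Hamiltonian vector field of the function `F` on `T^*M`: `D ⌟ ω₂ + dF = 0`. As `ω₂`
is nondegenerate, this determines `D`, and `D` is smooth if `F` is. -/
def IsHamiltonianField (F : CotangentBundle n M → ℂ) (D : ComplexField n M) : Prop :=
  ∀ (p : CotangentBundle n M) (w : TangentSpace (cotangentModel n) p),
    interior D p w + mvfderiv (cotangentModel n) F p w = 0

/-- `F` is a smooth complex function on `T^*M` that is polynomial along the fibres: for some `d`, it
is on each fibre `T_x^*M` a polynomial function of degree at most `d` with complex coefficients,
that is, a sum of homogeneous ones `ξ ↦ A(ξ, …, ξ)` with `A` multilinear. -/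
def IsFibrePolynomial (F : CotangentBundle n M → ℂ) : Prop :=
  ContMDiff (cotangentModel n) 𝓘(ℝ, ℂ) ∞ F ∧
  ∃ d : ℕ, ∀ x : M, ∃ A : ∀ k : ℕ, MultilinearMap ℝ (fun _ : Fin k => Cotangent n M x) ℂ,
    ∀ ξ : Cotangent n M x, F ⟨x, ξ⟩ = ∑ k ∈ Finset.range (d + 1), A k (fun _ => ξ)

variable (n M) in
/-- The infinitesimal canonical transformations of `T^*M` that correspond to functions which are
polynomial along the fibres. -/
def polynomialHamiltonianFields : Set (ComplexField n M) :=
  {D | ∃ F : CotangentBundle n M → ℂ, IsFibrePolynomial F ∧ IsHamiltonianField F D}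

/-- `D` is the Hamiltonian field associated with the operator `P` by the connection `cov`: it is the
Hamiltonian field of the function on `T^*M` given by the tensor field whose quantized is `P`. -/
def IsAssociatedField (ħ : ℝ) (cov : LinearConnection n M)
    (P : SmoothFun n M →ₗ[ℂ] SmoothFun n M) (D : ComplexField n M) : Prop :=
  ∃ Φ : SymTensor n M, IsQuantized ħ cov Φ P ∧ IsHamiltonianField (fibreFunction Φ) D

end Symplectic

end Quantization

end

set_option linter.unusedSectionVars false

noncomputable section

namespace Quantization

/-! ### Multilinear algebra -/

section Algebra

open scoped Pointwise

/-! Fix `x` and let 𝔪 be the ideal of functions vanishing at `x`. Hadamard's lemma identifies 𝔪/𝔪²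
with the complexified cotangent space (`sub_sum_coordSection_mem`). An operator `P` with `P(𝔪^(r+1))
⊆ 𝔪` induces a functional on 𝔪^r/𝔪^(r+1), and hence a symmetric `r`-linear form on `T_x^*M`, its
principal symbol. By polarization it suffices to know this functional on the powers `g^r` with `g ∈
𝔪`.

On powers the covariant differentials are explicit: at `x`, `∇^k(g^s)` vanishes for `k < s`, and
`∇^r(g^r) = r! dg ⊗ ⋯ ⊗ dg` (`exists_iteratedCov_pow`). So the quantized of a homogeneous `A` of
order `r` has symbol `(-iħ)^r r! A`. Subtracting the quantized of the suitably scaled symbol lowers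
the order of `P` (`sub_quantizeHom_symbol_mem`), and induction gives existence; testing the top
component on powers gives uniqueness. Two smoothness statements support this. Contractions with `∇^r
f` are smooth because `∇^r f` is a tensor (`IsTensorial.covStep`). Symbols are smooth because modulo
𝔪² their factors may be taken to be `f_i - f_i(x)` with global `f_i` (`contMDiff_symbolForm`).

For the second claim, `Φ ↦ F_Φ` is a bijection onto the fibrewise polynomial functions: the
homogeneous parts are linear combinations of the values on `0ξ, ξ, …, dξ`, and polarization recovers
the tensors (`eq_zero_of_fibreFunction_eq_zero`, `exists_fibreFunction_eq`). In cotangent charts `θ`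
is `p dq`, so `ω₂` is nondegenerate and every function has exactly one Hamiltonian field. Two smooth
functions share it exactly when their difference has zero differential, that is, is constant, `T^*M`
being connected. Constant functions correspond to constant tensors of order zero, whose quantized
operators are the multiples of the identity. -/

theorem sum_neg_one_pow_card_compl_of_subset {α : Type*} [Fintype α] [DecidableEq α]
    (T : Finset α) :
    ∑ S : Finset α, (if T ⊆ S then (-1 : ℤ) ^ Sᶜ.card else 0) =
      if T = Finset.univ then 1 else 0 := by
  have h1 : ∑ S : Finset α, (if T ⊆ S then (-1 : ℤ) ^ Sᶜ.card else 0)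
      = ∑ U ∈ Tᶜ.powerset, (-1 : ℤ) ^ U.card := by
    rw [← Finset.sum_filter]
    -- Complementation turns the supersets of `T` into the subsets of `Tᶜ`, whose alternating sum
    -- vanishes unless `Tᶜ` is empty.
    refine Finset.sum_bij' (fun S _ => Sᶜ) (fun U _ => Uᶜ) ?_ ?_ ?_ ?_ ?_
    · intro S hS
      simpa using hS
    · intro U hU
      simp only [Finset.mem_powerset] at hU
      simpa using Finset.compl_subset_compl.2 hU
    · simp
    · simp
    · simp
  rw [h1, Finset.sum_powerset_neg_one_pow_card]
  simp [Finset.compl_eq_empty_iff]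

/-- The polarization identity for symmetric multilinear maps. -/
theorem polarization {R V W : Type*} [CommRing R] [AddCommGroup V] [Module R V]
    [AddCommGroup W] [Module R W] {r : ℕ} (f : MultilinearMap R (fun _ : Fin r => V) W)
    (hf : ∀ (σ : Equiv.Perm (Fin r)) (v : Fin r → V), f (fun i => v (σ i)) = f v)
    (v : Fin r → V) :
    ∑ S : Finset (Fin r), (-1 : ℤ) ^ Sᶜ.card • f (fun _ => ∑ i ∈ S, v i) = r.factorial • f v := by
  classical
  -- Multilinear expansion: the terms are indexed by the maps `I` with image in `S`. Summing over
  -- `S` first, inclusion–exclusion keeps only the surjective `I`; these are the `r!` permutations,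
  -- and each contributes `f v` by symmetry.
  have h1 : ∀ S : Finset (Fin r), f (fun _ => ∑ i ∈ S, v i) =
      ∑ I : Fin r → Fin r, if Finset.univ.image I ⊆ S then f (fun k => v (I k)) else 0 := by
    intro S
    have := f.map_sum_finset (fun _ j => v j) (fun _ => S)
    rw [this, ← Finset.sum_filter]
    refine Finset.sum_congr ?_ fun _ _ => rfl
    ext I
    simp [Finset.image_subset_iff]
  have h2 : ∀ I : Fin r → Fin r,
      ∑ S : Finset (Fin r), (-1 : ℤ) ^ Sᶜ.card •
        (if Finset.univ.image I ⊆ S then f (fun k => v (I k)) else 0) =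
      if Function.Bijective I then f v else 0 := by
    intro I
    have : ∀ S : Finset (Fin r), (-1 : ℤ) ^ Sᶜ.card •
        (if Finset.univ.image I ⊆ S then f (fun k => v (I k)) else 0) =
        (if Finset.univ.image I ⊆ S then (-1 : ℤ) ^ Sᶜ.card else 0) • f (fun k => v (I k)) := by
      intro S; split_ifs <;> simp
    simp only [this]
    rw [← Finset.sum_smul, sum_neg_one_pow_card_compl_of_subset]
    by_cases hI : Function.Bijective I
    · have hI' : Finset.univ.image I = Finset.univ := Finset.image_univ_of_surjective hI.2
      rw [if_pos hI', if_pos hI, one_smul]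
      exact hf (Equiv.ofBijective I hI) v
    · have hI' : ¬ Finset.univ.image I = Finset.univ := by
        intro h
        refine hI ((Finite.surjective_iff_bijective).1 fun y => ?_)
        have : y ∈ Finset.univ.image I := by rw [h]; exact Finset.mem_univ y
        simpa using this
      rw [if_neg hI', if_neg hI, zero_smul]
  simp only [h1, Finset.smul_sum]
  rw [Finset.sum_comm]
  simp only [h2]
  rw [← Finset.sum_filter, Finset.sum_const]
  congr 1
  have e : Equiv.Perm (Fin r) ≃ {I : Fin r → Fin r // Function.Bijective I} :=
    ⟨fun σ => ⟨σ, σ.bijective⟩, fun I => Equiv.ofBijective I.1 I.2, fun σ => by ext; rfl,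
      fun I => rfl⟩
  rw [← Fintype.card_subtype, ← Fintype.card_congr e, Fintype.card_perm, Fintype.card_fin]

theorem eq_zero_of_diagonal_eq_zero {R V W : Type*} [CommRing R] [AddCommGroup V] [Module R V]
    [AddCommGroup W] [Module R W] [Module ℚ W] {r : ℕ}
    (f : MultilinearMap R (fun _ : Fin r => V) W)
    (hf : ∀ (σ : Equiv.Perm (Fin r)) (v : Fin r → V), f (fun i => v (σ i)) = f v)
    (h : ∀ v, f (fun _ => v) = 0) (v : Fin r → V) : f v = 0 := by
  have := polarization f hf v
  simp only [h, smul_zero, Finset.sum_const_zero] at this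
  have h3 : ((r.factorial : ℚ)) • f v = 0 := by rw [Nat.cast_smul_eq_nsmul, ← this]
  exact (smul_eq_zero.1 h3).resolve_left (by exact_mod_cast r.factorial_ne_zero)

/-- The map `(F_i) ↦ L (∏ F_i)` is symmetric and `ℂ`-multilinear on `I` seen as a complex vector
space, so polarization applies although `L` is not `A`-linear. -/
theorem linear_prod_eq_zero {A : Type*} [CommRing A] [Algebra ℂ A] (I : Ideal A) (L : A →ₗ[ℂ] ℂ)
    (s : ℕ) (h : ∀ g ∈ I, L (g ^ s) = 0) (F : Fin s → A) (hF : ∀ i, F i ∈ I) :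
    L (∏ i, F i) = 0 := by
  let J : Submodule ℂ A := I.restrictScalars ℂ
  let f : MultilinearMap ℂ (fun _ : Fin s => J) ℂ :=
    L.compMultilinearMap ((MultilinearMap.mkPiAlgebra ℂ (Fin s) A).compLinearMap fun _ => J.subtype)
  have hf : ∀ v, f v = L (∏ i, (v i : A)) := fun v => rfl
  have := eq_zero_of_diagonal_eq_zero f ?_ ?_ (fun i => ⟨F i, hF i⟩)
  · simpa [hf] using this
  · intro σ v
    rw [hf, hf, Equiv.prod_comp σ (fun i => (v i : A))]
  · intro v
    rw [hf]
    simpa using h v v.2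

/-- Products of `s` elements of `I` span `I ^ s` over `A` only, while `L` is `ℂ`-linear; hence the
coefficient `a` has to be carried along. -/
theorem mem_pow_induction {A : Type*} [CommRing A] [Algebra ℂ A] (I : Ideal A) (L : A →ₗ[ℂ] ℂ)
    (s : ℕ) (h : ∀ (a : A) (F : Fin s → A), (∀ i, F i ∈ I) → L (a * ∏ i, F i) = 0)
    (f : A) (hf : f ∈ I ^ s) : L f = 0 := by
  suffices H : ∀ a, L (a * f) = 0 by simpa using H 1
  have hspan : I ^ s = Submodule.span A ((I : Set A) ^ s) := Submodule.pow_eq_span_pow_set I s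
  rw [hspan] at hf
  induction hf using Submodule.span_induction with
  | mem x hx =>
    intro a
    obtain ⟨F, rfl⟩ := Set.mem_pow.1 hx
    rw [List.prod_ofFn]
    exact h a _ fun i => (F i).2
  | zero => simp
  | add x y _ _ hx hy => intro a; rw [mul_add, map_add, hx, hy, add_zero]
  | smul b x _ hx => intro a; rw [smul_eq_mul, ← mul_assoc]; exact hx _

/-- There is at least one factor, and it absorbs the coefficient. -/
theorem linear_eq_zero_of_mem_pow_succ {A : Type*} [CommRing A] [Algebra ℂ A] (I : Ideal A)
    (L : A →ₗ[ℂ] ℂ) (s : ℕ) (h : ∀ g ∈ I, L (g ^ (s + 1)) = 0) (f : A) (hf : f ∈ I ^ (s + 1)) :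
    L f = 0 := by
  refine mem_pow_induction I L (s + 1) (fun a F hF => ?_) f hf
  have := linear_prod_eq_zero I L (s + 1) h (Fin.cons (a * F 0) (Fin.tail F)) ?_
  · rw [Fin.prod_univ_succ] at this ⊢
    simpa [Fin.tail, mul_assoc] using this
  · intro i
    refine Fin.cases ?_ (fun i => ?_) i
    · exact I.mul_mem_left _ (hF 0)
    · exact hF i.succ

/-- For `s = 0` no factor can absorb the coefficient. Instead it is split into a constant, treated
by polarization, and an element of `I`, which pushes the product into `I ^ (s + 1)`. -/
theorem linear_eq_zero_of_mem_pow {A : Type*} [CommRing A] [Algebra ℂ A] (I : Ideal A)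
    (hI : ∀ a : A, ∃ c : ℂ, a - algebraMap ℂ A c ∈ I)
    (L : A →ₗ[ℂ] ℂ) (s : ℕ) (h : ∀ g ∈ I, L (g ^ s) = 0) (h' : ∀ f ∈ I ^ (s + 1), L f = 0)
    (f : A) (hf : f ∈ I ^ s) : L f = 0 := by
  refine mem_pow_induction I L s (fun a F hF => ?_) f hf
  obtain ⟨c, hc⟩ := hI a
  have e : a * ∏ i, F i = (a - algebraMap ℂ A c) * ∏ i, F i + c • ∏ i, F i := by
    rw [Algebra.smul_def]; ring
  rw [e, map_add, map_smul, linear_prod_eq_zero I L s h F hF, smul_zero, add_zero]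
  refine h' _ ?_
  rw [pow_succ']
  refine Ideal.mul_mem_mul hc ?_
  simpa using Ideal.prod_mem_prod (s := Finset.univ) (I := fun _ : Fin s => I) fun i _ => hF i

/-- Factors are exchanged one at a time: the changed factor contributes an element of `I ^ 2`, the
other `r - 1` factors one of `I` each. -/
theorem prod_sub_prod_mem {A : Type*} [CommRing A] (I : Ideal A) {r : ℕ} (a b : Fin r → A)
    (ha : ∀ i, a i ∈ I) (hb : ∀ i, b i ∈ I) (hab : ∀ i, a i - b i ∈ I ^ 2) :
    ∏ i, a i - ∏ i, b i ∈ I ^ (r + 1) := by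
  induction r with
  | zero => simp
  | succ r ih =>
    rw [Fin.prod_univ_succ, Fin.prod_univ_succ]
    have e : a 0 * ∏ i : Fin r, a i.succ - b 0 * ∏ i : Fin r, b i.succ =
        (a 0 - b 0) * ∏ i : Fin r, a i.succ +
          b 0 * (∏ i : Fin r, a i.succ - ∏ i : Fin r, b i.succ) := by ring
    rw [e]
    refine Ideal.add_mem _ ?_ ?_
    · have h1 : ∏ i : Fin r, a i.succ ∈ I ^ r := by
        simpa using Ideal.prod_mem_prod (s := Finset.univ) (I := fun _ : Fin r => I)
          (x := fun i => a i.succ) fun i _ => ha _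
      have := Ideal.mul_mem_mul (hab 0) h1
      rwa [← pow_add, add_comm 2 r] at this
    · have := Ideal.mul_mem_mul (hb 0) (ih (fun i => a i.succ) (fun i => b i.succ)
        (fun i => ha _) (fun i => hb _) fun i => hab _)
      rwa [← pow_succ'] at this

/-- Both sides expand to the same double sum, since `m` transforms the two families
contragrediently. Linear independence plays no role. -/
theorem sum_mul_basis_change {V U ι κ : Type*} [AddCommGroup V] [Module ℝ V] [AddCommGroup U]
    [Module ℝ U] [Fintype ι] [Fintype κ] {r : ℕ} (A : MultilinearMap ℝ (fun _ : Fin r => U) ℂ)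
    (B : MultilinearMap ℝ (fun _ : Fin r => V) ℂ) (b : ι → V) (β : ι → U) (c : κ → V) (γ : κ → U)
    (m : κ → ι → ℝ) (hγ : ∀ k, γ k = ∑ i, m k i • β i) (hb : ∀ i, b i = ∑ k, m k i • c k) :
    ∑ J : Fin r → ι, A (fun l => β (J l)) * B (fun l => b (J l)) =
      ∑ K : Fin r → κ, A (fun l => γ (K l)) * B (fun l => c (K l)) := by
  classical
  simp only [hγ, hb, MultilinearMap.map_sum, MultilinearMap.map_smul_univ]
  simp only [Finset.mul_sum, Finset.sum_mul]
  rw [Finset.sum_comm]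
  refine Finset.sum_congr rfl fun K _ => Finset.sum_congr rfl fun J _ => ?_
  simp only [Complex.real_smul]
  ring

/-- The Vandermonde matrix of the nodes `0, …, d` is invertible. The extraction coefficients `c` do
not depend on the polynomial; applied fibre by fibre they are therefore constant on `M` and preserve
smoothness. -/
theorem exists_coeff_extraction (d : ℕ) : ∃ c : ℕ → Fin (d + 1) → ℂ, ∀ (a : ℕ → ℂ),
    ∀ k ∈ Finset.range (d + 1),
      a k = ∑ t : Fin (d + 1), c k t * ∑ j ∈ Finset.range (d + 1), a j * ((t : ℕ) : ℂ) ^ j := by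
  let v : Fin (d + 1) → ℂ := fun t => ((t : ℕ) : ℂ)
  let W := Matrix.vandermonde v
  have hW : IsUnit W.det := by
    rw [isUnit_iff_ne_zero, Matrix.det_vandermonde_ne_zero_iff]
    intro i j h
    exact Fin.ext (by simpa [v] using h)
  refine ⟨fun k t => if h : k < d + 1 then W⁻¹ ⟨k, h⟩ t else 0, fun a k hk => ?_⟩
  have hk' : k < d + 1 := Finset.mem_range.1 hk
  have h1 := congrFun (congrArg (fun X => Matrix.mulVec X (fun j : Fin (d + 1) => a j))
    (Matrix.nonsing_inv_mul W hW)) ⟨k, hk'⟩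
  simp only [Matrix.one_mulVec, ← Matrix.mulVec_mulVec] at h1
  rw [← h1]
  simp only [hk', dif_pos]
  simp only [Matrix.mulVec, dotProduct]
  refine Finset.sum_congr rfl fun t _ => ?_
  congr 1
  rw [Finset.sum_range]
  refine Finset.sum_congr rfl fun j _ => ?_
  simp [W, Matrix.vandermonde_apply, v, mul_comm]

end Algebra

/-! ### Hadamard's lemma -/

section Hadamard

open MeasureTheory Set Metric

/-- Differentiation under the integral, by induction on `k`. The derivative is again such an
integral, with values in `E →L[ℝ] V`, so `V` must vary in the induction. -/
theorem contDiff_intervalIntegral_param_nat {E : Type} [NormedAddCommGroup E] [NormedSpace ℝ E]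
    [FiniteDimensional ℝ E] (k : ℕ) : ∀ {V : Type} [NormedAddCommGroup V] [NormedSpace ℝ V]
    [CompleteSpace V] {G : E × ℝ → V}, ContDiff ℝ k G →
      ContDiff ℝ k (fun u => ∫ t in (0 : ℝ)..1, G (u, t)) := by
  induction k with
  | zero =>
    intro V _ _ _ G hG
    have hG' : Continuous G := hG.continuous
    refine contDiff_zero.2 ?_
    exact intervalIntegral.continuous_parametric_intervalIntegral_of_continuous'
      (f := fun u t => G (u, t)) (by simpa [Function.uncurry_def] using hG') 0 1
  | succ k ih =>
    intro V _ _ _ G hG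
    have hG1 : ContDiff ℝ 1 G := hG.of_le (by exact_mod_cast Nat.le_add_left 1 k)
    let G' : E × ℝ → E →L[ℝ] V := fun p => (fderiv ℝ G p).comp (ContinuousLinearMap.inl ℝ E ℝ)
    have hG' : ContDiff ℝ k G' := by
      have : ContDiff ℝ k (fderiv ℝ G) := hG.fderiv_right (by norm_cast)
      exact this.clm_comp contDiff_const
    have hd : ∀ u t, HasFDerivAt (fun u => G (u, t)) (G' (u, t)) u := by
      intro u t
      have h1 : HasFDerivAt G (fderiv ℝ G (u, t)) (u, t) :=
        (hG1.differentiable one_ne_zero _).hasFDerivAt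
      exact h1.comp u (hasFDerivAt_prodMk_left u t)
    have hc : Continuous G := hG.continuous
    have hc' : Continuous G' := hG'.continuous
    refine (contDiff_succ_iff_hasFDerivAt (n := k)).2
      ⟨fun u => ∫ t in (0 : ℝ)..1, G' (u, t), ih hG', fun u => ?_⟩
    -- Compactness of the unit ball around `u` times `[0, 1]` supplies a constant dominating
    -- function.
    obtain ⟨C, hC⟩ := ((isCompact_closedBall u 1).prod
      (isCompact_Icc (a := (0 : ℝ)) (b := 1))).exists_bound_of_continuousOn hc'.continuousOn
    refine intervalIntegral.hasFDerivAt_integral_of_dominated_of_fderiv_le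
      (F := fun u t => G (u, t)) (F' := fun u t => G' (u, t)) (bound := fun _ => C)
      (closedBall_mem_nhds u one_pos) ?_ ?_ ?_ ?_ ?_ ?_
    · exact Filter.Eventually.of_forall fun v => (hc.comp (by fun_prop)).aestronglyMeasurable
    · exact (hc.comp (by fun_prop : Continuous fun t : ℝ => (u, t))).intervalIntegrable 0 1
    · exact (hc'.comp (by fun_prop : Continuous fun t : ℝ => (u, t))).aestronglyMeasurable
    · refine Filter.Eventually.of_forall fun t ht v hv => hC (v, t) ⟨hv, ?_⟩
      rw [uIoc_of_le zero_le_one] at ht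
      exact ⟨ht.1.le, ht.2⟩
    · exact intervalIntegrable_const
    · exact Filter.Eventually.of_forall fun t _ v _ => hd v t

theorem contDiff_intervalIntegral_param {E V : Type} [NormedAddCommGroup E] [NormedSpace ℝ E]
    [FiniteDimensional ℝ E] [NormedAddCommGroup V] [NormedSpace ℝ V]
    [CompleteSpace V] {G : E × ℝ → V} (hG : ContDiff ℝ ∞ G) :
    ContDiff ℝ ∞ (fun u => ∫ t in (0 : ℝ)..1, G (u, t)) :=
  contDiff_infty.2 fun k => contDiff_intervalIntegral_param_nat k (contDiff_infty.1 hG k)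

/-- Hadamard's lemma for a smooth function on a Euclidean space. -/
theorem hadamard {n : ℕ} {F : EuclideanSpace ℝ (Fin n) → ℂ} (hF : ContDiff ℝ ∞ F)
    (u₀ : EuclideanSpace ℝ (Fin n)) :
    ∃ h : Fin n → EuclideanSpace ℝ (Fin n) → ℂ, (∀ i, ContDiff ℝ ∞ (h i)) ∧
      (∀ i, h i u₀ = fderiv ℝ F u₀ (EuclideanSpace.basisFun (Fin n) ℝ i)) ∧
      ∀ u, F u = F u₀ + ∑ i, ((u i - u₀ i : ℝ) : ℂ) * h i u := by
  have hF' : ContDiff ℝ ∞ (fderiv ℝ F) := hF.fderiv_right (by simp)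
  have hG : ∀ i : Fin n, ContDiff ℝ ∞ (fun p : EuclideanSpace ℝ (Fin n) × ℝ =>
      fderiv ℝ F (u₀ + p.2 • (p.1 - u₀)) (EuclideanSpace.basisFun (Fin n) ℝ i)) := by
    intro i
    refine ContDiff.clm_apply (hF'.comp ?_) contDiff_const
    exact contDiff_const.add (contDiff_snd.smul (contDiff_fst.sub contDiff_const))
  -- The fundamental theorem of calculus along the segment from `u₀` to `u`; the coefficient at `u₀`
  -- has a constant integrand.
  refine ⟨fun i u => ∫ t in (0 : ℝ)..1,
    fderiv ℝ F (u₀ + t • (u - u₀)) (EuclideanSpace.basisFun (Fin n) ℝ i),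
    fun i => contDiff_intervalIntegral_param (hG i), fun i => ?_, fun u => ?_⟩
  · simp
  · have hd : ∀ t ∈ uIcc (0 : ℝ) 1, HasDerivAt (fun t : ℝ => F (u₀ + t • (u - u₀)))
        (fderiv ℝ F (u₀ + t • (u - u₀)) (u - u₀)) t := by
      intro t _
      have h1 : HasFDerivAt F (fderiv ℝ F (u₀ + t • (u - u₀))) (u₀ + t • (u - u₀)) :=
        (hF.differentiable (by simp) _).hasFDerivAt
      have h2 : HasDerivAt (fun t : ℝ => u₀ + t • (u - u₀)) (u - u₀) t := by
        simpa using ((hasDerivAt_id t).smul_const (u - u₀)).const_add u₀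
      exact h1.comp_hasDerivAt t h2
    have hcont : Continuous fun t : ℝ => fderiv ℝ F (u₀ + t • (u - u₀)) (u - u₀) :=
      (hF'.continuous.comp (by fun_prop)).clm_apply continuous_const
    have := intervalIntegral.integral_eq_sub_of_hasDerivAt hd (hcont.intervalIntegrable 0 1)
    simp only [one_smul, zero_smul, add_zero, add_sub_cancel] at this
    rw [eq_comm, sub_eq_iff_eq_add'] at this
    rw [this]
    congr 1
    have e : u - u₀ = ∑ i, (u i - u₀ i) • EuclideanSpace.basisFun (Fin n) ℝ i := by
      conv_lhs => rw [← (EuclideanSpace.basisFun (Fin n) ℝ).sum_repr (u - u₀)]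
      simp
    have e2 : ∀ t : ℝ, fderiv ℝ F (u₀ + t • (u - u₀)) (u - u₀) = ∑ i, ((u i - u₀ i : ℝ) : ℂ) *
        fderiv ℝ F (u₀ + t • (u - u₀)) (EuclideanSpace.basisFun (Fin n) ℝ i) := by
      intro t
      conv_lhs => rw [e, map_sum, ← e]
      simp only [map_smul, Complex.real_smul]
    simp only [e2]
    rw [intervalIntegral.integral_finsetSum]
    · simp only [intervalIntegral.integral_const_mul]
    · intro i _
      have : Continuous fun t : ℝ =>
          fderiv ℝ F (u₀ + t • (u - u₀)) (EuclideanSpace.basisFun (Fin n) ℝ i) :=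
        (hF'.continuous.comp (by fun_prop)).clm_apply continuous_const
      exact (continuous_const.mul this).intervalIntegrable 0 1

end Hadamard

/-! ### The ideals of functions vanishing at a point -/

section VanishingIdeal

open Set

variable {n : ℕ} {M : Type*} [TopologicalSpace M] [ChartedSpace (EuclideanSpace ℝ (Fin n)) M]

/-- A smooth complex function as element of `SmoothFun n M`. -/
def SmoothFun.mk (f : M → ℂ) (hf : ContMDiff (𝓡 n) 𝓘(ℝ, ℂ) ∞ f) : SmoothFun n M := ⟨f, hf⟩

theorem SmoothFun.mk_apply (f : M → ℂ) (hf : ContMDiff (𝓡 n) 𝓘(ℝ, ℂ) ∞ f) (x : M) :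
    SmoothFun.mk f hf x = f x := rfl

theorem SmoothFun.contMDiff (f : SmoothFun n M) : ContMDiff (𝓡 n) 𝓘(ℝ, ℂ) ∞ (f : M → ℂ) := f.2

theorem SmoothFun.ext {f g : SmoothFun n M} (h : ∀ x, f x = g x) : f = g :=
  Subtype.ext (funext h)

theorem SmoothFun.one_apply (x : M) : (1 : SmoothFun n M) x = 1 := rfl

theorem SmoothFun.sub_apply (f g : SmoothFun n M) (x : M) : (f - g) x = f x - g x := rfl

theorem SmoothFun.algebraMap_apply (c : ℂ) (x : M) : (algebraMap ℂ (SmoothFun n M) c) x = c := rfl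

/-- Evaluation at a point. -/
def SmoothFun.eval (x : M) : SmoothFun n M →ₐ[ℂ] ℂ :=
  (Pi.evalAlgHom ℂ (fun _ : M => ℂ) x).comp (smoothFunctions n M).val

theorem SmoothFun.sum_apply {ι : Type*} (s : Finset ι) (f : ι → SmoothFun n M) (x : M) :
    (∑ i ∈ s, f i) x = ∑ i ∈ s, f i x :=
  map_sum (SmoothFun.eval x) f s

theorem SmoothFun.prod_apply {ι : Type*} (s : Finset ι) (f : ι → SmoothFun n M) (x : M) :
    (∏ i ∈ s, f i) x = ∏ i ∈ s, f i x :=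
  map_prod (SmoothFun.eval x) f s

theorem SmoothFun.pow_apply (f : SmoothFun n M) (k : ℕ) (x : M) : (f ^ k) x = f x ^ k :=
  map_pow (SmoothFun.eval x) f k

theorem mem_vanishingIdeal {x : M} {f : SmoothFun n M} : f ∈ vanishingIdeal n x ↔ f x = 0 :=
  Iff.rfl

theorem sub_algebraMap_mem (x : M) (f : SmoothFun n M) :
    f - algebraMap ℂ (SmoothFun n M) (f x) ∈ vanishingIdeal n x := by
  rw [mem_vanishingIdeal, SmoothFun.sub_apply, SmoothFun.algebraMap_apply, sub_self]

/-- A real smooth function as complex smooth function. -/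
def SmoothFun.ofReal (f : M → ℝ) (hf : ContMDiff (𝓡 n) 𝓘(ℝ, ℝ) ∞ f) : SmoothFun n M :=
  SmoothFun.mk (fun x => (f x : ℂ)) (Complex.ofRealCLM.contDiff.contMDiff.comp hf)

theorem SmoothFun.ofReal_apply (f : M → ℝ) (hf : ContMDiff (𝓡 n) 𝓘(ℝ, ℝ) ∞ f) (x : M) :
    SmoothFun.ofReal f hf x = (f x : ℂ) := rfl

variable [IsManifold (𝓡 n) ∞ M]

variable (n) in
/-- A bump function at `x`. -/
def bump (x : M) : SmoothBumpFunction (𝓡 n) x := Classical.arbitrary _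

/-- The function `g ∘ φ_x`, multiplied with the bump function at `x`. -/
def bumpPullback {V : Type*} [NormedAddCommGroup V] [NormedSpace ℝ V] (x : M)
    (g : EuclideanSpace ℝ (Fin n) → V) (y : M) : V :=
  bump n x y • g (extChartAt (𝓡 n) x y)

theorem contMDiff_bumpPullback [T2Space M] {V : Type*} [NormedAddCommGroup V] [NormedSpace ℝ V]
    (x : M) {g : EuclideanSpace ℝ (Fin n) → V} (hg : ContDiff ℝ ∞ g) :
    ContMDiff (𝓡 n) 𝓘(ℝ, V) ∞ (bumpPullback x g) :=
  (bump n x).contMDiff_smul (hg.contMDiff.comp_contMDiffOn contMDiffOn_extChartAt)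

theorem bumpPullback_eventuallyEq {V : Type*} [NormedAddCommGroup V] [NormedSpace ℝ V] (x : M)
    (g : EuclideanSpace ℝ (Fin n) → V) :
    bumpPullback x g =ᶠ[nhds x] fun y => g (extChartAt (𝓡 n) x y) := by
  filter_upwards [(bump n x).eventuallyEq_one] with y hy
  simp [bumpPullback, hy]

/-- The bump function on the model space used in a chart. -/
theorem contDiff_bump_smul_comp_symm (x : M) (f : SmoothFun n M) :
    ContDiff ℝ ∞
      (fun u => ((bump n x).toContDiffBump u : ℝ) • f ((extChartAt (𝓡 n) x).symm u)) := by
  rw [contDiff_iff_contDiffAt]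
  intro u
  by_cases hu : u ∈ (extChartAt (𝓡 n) x).target
  · have h1 : ContDiffAt ℝ ∞ (fun u => f ((extChartAt (𝓡 n) x).symm u)) u := by
      rw [← contMDiffAt_iff_contDiffAt]
      exact (f.contMDiff _).comp u
        ((contMDiffOn_extChartAt_symm x).contMDiffAt ((isOpen_extChartAt_target x).mem_nhds hu))
    exact ((bump n x).toContDiffBump.contDiffAt).smul h1
  -- The closed ball carrying the bump lies in the chart target, so outside the target the product
  -- vanishes on a neighbourhood.
  · have h2 : u ∉ Metric.closedBall (extChartAt (𝓡 n) x x) (bump n x).rOut := by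
      intro h
      apply hu
      have := (bump n x).closedBall_subset
      exact this ⟨h, by simp⟩
    refine contDiffAt_const (c := 0) |>.congr_of_eventuallyEq ?_
    filter_upwards [Metric.isClosed_closedBall.isOpen_compl.mem_nhds h2] with w hw
    have : (bump n x).toContDiffBump w = 0 := by
      apply (bump n x).toContDiffBump.zero_of_le_dist
      simp only [mem_compl_iff, Metric.mem_closedBall, not_le] at hw
      exact hw.le
    rw [this, zero_smul]

variable (n) in
/-- A linear section of the map `f ↦ df_x` on the functions that vanish at `x`. -/
def coordSection [T2Space M] (x : M) : Cotangent n M x →ₗ[ℝ] SmoothFun n M where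
  toFun ξ := SmoothFun.ofReal
    (bumpPullback x fun u => (ξ : EuclideanSpace ℝ (Fin n) →L[ℝ] ℝ) (u - extChartAt (𝓡 n) x x))
    (contMDiff_bumpPullback x ((ContinuousLinearMap.contDiff _).comp
      (contDiff_id.sub contDiff_const)))
  map_add' ξ η := SmoothFun.ext fun y => by
    rw [SmoothFun.add_apply]
    simp only [SmoothFun.ofReal_apply, ← Complex.ofReal_add, bumpPullback, ← smul_add]
    rfl
  map_smul' c ξ := SmoothFun.ext fun y => by
    have : ∀ (c : ℝ) (f : SmoothFun n M), (c • f) y = c * f y := fun c f => rfl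
    rw [RingHom.id_apply, this]
    simp only [SmoothFun.ofReal_apply, ← Complex.ofReal_mul, bumpPullback]
    rw [← smul_eq_mul c, smul_comm]
    rfl

theorem coordSection_apply [T2Space M] (x : M) (ξ : Cotangent n M x) (y : M) :
    coordSection n x ξ y = ((bumpPullback x
      (fun u => (ξ : EuclideanSpace ℝ (Fin n) →L[ℝ] ℝ) (u - extChartAt (𝓡 n) x x)) y : ℝ) : ℂ) :=
  rfl

theorem coordSection_mem [T2Space M] (x : M) (ξ : Cotangent n M x) :
    coordSection n x ξ ∈ vanishingIdeal n x := by
  let ξ' : EuclideanSpace ℝ (Fin n) →L[ℝ] ℝ := ξ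
  show ((bump n x x • ξ' (extChartAt (𝓡 n) x x - extChartAt (𝓡 n) x x) : ℝ) : ℂ) = 0
  rw [sub_self, map_zero, smul_zero, Complex.ofReal_zero]

theorem SmoothFun.mdifferentiableAt (f : SmoothFun n M) (x : M) :
    MDifferentiableAt (𝓡 n) 𝓘(ℝ, ℂ) (f : M → ℂ) x :=
  (f.contMDiff x).mdifferentiableAt (by simp)

theorem mvfderiv_congr {V : Type*} [NormedAddCommGroup V] [NormedSpace ℝ V] {f g : M → V} {x : M}
    (h : f =ᶠ[nhds x] g) : mvfderiv (𝓡 n) f x = mvfderiv (𝓡 n) g x := by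
  ext v
  have h1 := h.mfderiv_eq (I := 𝓡 n) (I' := 𝓘(ℝ, V))
  simp only [mvfderiv, h1]
  rfl

theorem mvfderiv_comp_extChartAt {V : Type*} [NormedAddCommGroup V] [NormedSpace ℝ V] (x : M)
    {g : EuclideanSpace ℝ (Fin n) → V} (hg : Differentiable ℝ g) {y : M}
    (hy : y ∈ (chartAt (EuclideanSpace ℝ (Fin n)) x).source) (v : TangentSpace (𝓡 n) y) :
    mvfderiv (𝓡 n) (fun y => g (extChartAt (𝓡 n) x y)) y v =
      fderiv ℝ g (extChartAt (𝓡 n) x y)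
        (mfderiv (𝓡 n) 𝓘(ℝ, EuclideanSpace ℝ (Fin n)) (extChartAt (𝓡 n) x) y v) := by
  have h1 : MDifferentiableAt (𝓡 n) 𝓘(ℝ, EuclideanSpace ℝ (Fin n)) (extChartAt (𝓡 n) x) y :=
    mdifferentiableAt_extChartAt hy
  have h2 : MDifferentiableAt 𝓘(ℝ, EuclideanSpace ℝ (Fin n)) 𝓘(ℝ, V) g (extChartAt (𝓡 n) x y) :=
    (hg _).mdifferentiableAt
  have := mfderiv_comp y h2 h1
  have h3 : mvfderiv (𝓡 n) (fun y => g (extChartAt (𝓡 n) x y)) y v =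
    mfderiv (𝓡 n) 𝓘(ℝ, V) (g ∘ extChartAt (𝓡 n) x) y v := rfl
  rw [h3, this, mfderiv_eq_fderiv]
  rfl

theorem mvfderiv_bumpPullback_self {V : Type*} [NormedAddCommGroup V] [NormedSpace ℝ V] (x : M)
    {g : EuclideanSpace ℝ (Fin n) → V} (hg : Differentiable ℝ g) (v : TangentSpace (𝓡 n) x) :
    mvfderiv (𝓡 n) (bumpPullback x g) x v = fderiv ℝ g (extChartAt (𝓡 n) x x) v := by
  rw [mvfderiv_congr (bumpPullback_eventuallyEq x g),
    mvfderiv_comp_extChartAt x hg (mem_chart_source _ x), mfderiv_extChartAt_self]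
  rfl

theorem mvfderiv_ofReal_apply {f : M → ℝ} {x : M} (hf : MDifferentiableAt (𝓡 n) 𝓘(ℝ, ℝ) f x)
    (v : TangentSpace (𝓡 n) x) :
    mvfderiv (𝓡 n) (fun y => (f y : ℂ)) x v = ((mvfderiv (𝓡 n) f x v : ℝ) : ℂ) := by
  have h2 : MDifferentiableAt 𝓘(ℝ, ℝ) 𝓘(ℝ, ℂ) Complex.ofRealCLM (f x) :=
    Complex.ofRealCLM.differentiableAt.mdifferentiableAt
  have := mfderiv_comp x h2 hf
  have h3 : mvfderiv (𝓡 n) (fun y => (f y : ℂ)) x v =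
    mfderiv (𝓡 n) 𝓘(ℝ, ℂ) (Complex.ofRealCLM ∘ f) x v := rfl
  rw [h3, this, mfderiv_eq_fderiv, Complex.ofRealCLM.fderiv]
  rfl

theorem mvfderiv_coordSection [T2Space M] (x : M) (ξ : Cotangent n M x)
    (v : TangentSpace (𝓡 n) x) :
    mvfderiv (𝓡 n) (coordSection n x ξ : M → ℂ) x v = ((ξ v : ℝ) : ℂ) := by
  let ξ' : EuclideanSpace ℝ (Fin n) →L[ℝ] ℝ := ξ
  have hc : ContDiff ℝ ∞ fun u => ξ' (u - extChartAt (𝓡 n) x x) :=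
    ξ'.contDiff.comp (contDiff_id.sub contDiff_const)
  have h1 := mvfderiv_ofReal_apply ((contMDiff_bumpPullback x hc x).mdifferentiableAt (by simp)) v
  have h2 := mvfderiv_bumpPullback_self x (hc.differentiable (by simp)) v
  have h3 : HasFDerivAt (fun u => ξ' (u - extChartAt (𝓡 n) x x)) ξ' (extChartAt (𝓡 n) x x) := by
    have := ξ'.hasFDerivAt.comp (extChartAt (𝓡 n) x x)
      ((hasFDerivAt_id _).sub_const (extChartAt (𝓡 n) x x))
    rwa [ContinuousLinearMap.comp_id] at this
  rw [h3.fderiv] at h2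
  rw [h2] at h1
  exact h1

/-- Near `x`, Hadamard gives `f = ∑ (x_i - x_i(x)) h_i` with `h_i(x) = ∂_i f(x)`; replacing each
`h_i` by its value at `x` costs an element of `𝔪_x ^ 2`. Thus `𝔪_x / 𝔪_x ^ 2` is spanned by the
coordinate sections. -/
theorem sub_sum_coordSection_mem [T2Space M] (x : M) (f : SmoothFun n M)
    (hf : f ∈ vanishingIdeal n x) :
    f - ∑ i, mvfderiv (𝓡 n) (f : M → ℂ) x (tangentBasis x i) • coordSection n x (dualBasis x i) ∈
      vanishingIdeal n x ^ 2 := by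
  obtain ⟨h, hh, hh0, hF⟩ := hadamard (contDiff_bump_smul_comp_symm x f) (extChartAt (𝓡 n) x x)
  let χ : SmoothFun n M := SmoothFun.ofReal (bump n x) (bump n x).contMDiff
  let H : Fin n → SmoothFun n M := fun i =>
    SmoothFun.mk (bumpPullback x (h i)) (contMDiff_bumpPullback x (hh i))
  -- Why the cube: one factor `χ` globalizes `f` in the chart, one is built into `coordSection` and
  -- one into `H i`. The error `(1 - χ ^ 3) * f` is a product of two elements of `𝔪_x`.
  have hχ : 1 - χ ^ 3 ∈ vanishingIdeal n x := by
    rw [mem_vanishingIdeal, SmoothFun.sub_apply, SmoothFun.one_apply, SmoothFun.pow_apply,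
      SmoothFun.ofReal_apply, (bump n x).eq_one]
    simp
  have hd : ∀ i, h i (extChartAt (𝓡 n) x x) =
      mvfderiv (𝓡 n) (f : M → ℂ) x (tangentBasis x i) := by
    intro i
    have e : (fun u => ((bump n x).toContDiffBump u : ℝ) • f ((extChartAt (𝓡 n) x).symm u))
        =ᶠ[nhds (extChartAt (𝓡 n) x x)] writtenInExtChartAt (𝓡 n) 𝓘(ℝ, ℂ) x (f : M → ℂ) := by
      filter_upwards [(bump n x).toContDiffBump.eventuallyEq_one] with u hu
      rw [hu]
      exact one_smul ℝ (f ((extChartAt (𝓡 n) x).symm u))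
    rw [hh0, (f.mdifferentiableAt x).mvfderiv, ModelWithCorners.range_eq_univ, fderivWithin_univ,
      e.fderiv_eq]
    exact congrArg _ (congrFun (EuclideanSpace.basisFun (Fin n) ℝ).coe_toBasis i).symm
  have key : f - ∑ i, mvfderiv (𝓡 n) (f : M → ℂ) x (tangentBasis x i) •
      coordSection n x (dualBasis x i) = (1 - χ ^ 3) * f + ∑ i, coordSection n x (dualBasis x i) *
        (H i - algebraMap ℂ (SmoothFun n M) (mvfderiv (𝓡 n) (f : M → ℂ) x (tangentBasis x i)))
      := by
    refine SmoothFun.ext fun y => ?_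
    simp only [SmoothFun.sub_apply, SmoothFun.add_apply, SmoothFun.mul_apply, SmoothFun.sum_apply,
      SmoothFun.smul_apply, SmoothFun.one_apply, SmoothFun.pow_apply, SmoothFun.algebraMap_apply]
    simp only [mul_sub, Finset.sum_sub_distrib]
    have e1 : χ y ^ 3 * f y = ∑ i, coordSection n x (dualBasis x i) y * H i y := by
      by_cases hy : y ∈ (chartAt (EuclideanSpace ℝ (Fin n)) x).source
      · have hχy : (bump n x).toContDiffBump (extChartAt (𝓡 n) x y) = bump n x y :=
          ((bump n x).eqOn_source hy).symm
        have e2 := hF (extChartAt (𝓡 n) x y)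
        have hy' : y ∈ (extChartAt (𝓡 n) x).source := by rwa [extChartAt_source]
        have hf0 : f x = 0 := hf
        simp only [hχy, (extChartAt (𝓡 n) x).left_inv hy', extChartAt_to_inv, hf0, smul_zero,
          zero_add] at e2
        have e3 : χ y ^ 3 * f y = χ y ^ 2 * ((bump n x y : ℝ) • f y) := by
          rw [Complex.real_smul]
          show ((bump n x y : ℝ) : ℂ) ^ 3 * _ = ((bump n x y : ℝ) : ℂ) ^ 2 * _
          ring
        rw [e3, e2, Finset.mul_sum]
        refine Finset.sum_congr rfl fun i _ => ?_
        have e4 : coordSection n x (dualBasis x i) y = ((bump n x y : ℝ) : ℂ) *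
            ((extChartAt (𝓡 n) x y i - extChartAt (𝓡 n) x x i : ℝ) : ℂ) := by
          rw [coordSection_apply, ← Complex.ofReal_mul]
          rfl
        have e5 : H i y = ((bump n x y : ℝ) : ℂ) * h i (extChartAt (𝓡 n) x y) := by
          show bumpPullback x (h i) y = _
          rw [bumpPullback, Complex.real_smul]
        rw [e4, e5]
        show ((bump n x y : ℝ) : ℂ) ^ 2 * _ = _
        ring
      · have h0 : bump n x y = 0 := by
          by_contra h
          exact hy ((bump n x).support_subset_source h)
        have h1 : χ y = 0 := by
          show ((bump n x y : ℝ) : ℂ) = 0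
          rw [h0, Complex.ofReal_zero]
        have h2 : ∀ i, H i y = 0 := fun i => by
          show bumpPullback x (h i) y = 0
          rw [bumpPullback, h0, zero_smul]
        simp [h1, h2]
    have e2 : ∀ i, coordSection n x (dualBasis x i) y *
        mvfderiv (𝓡 n) (f : M → ℂ) x (tangentBasis x i) =
        mvfderiv (𝓡 n) (f : M → ℂ) x (tangentBasis x i) * coordSection n x (dualBasis x i) y :=
      fun i => mul_comm _ _
    rw [← e1]
    simp only [e2]
    ring
  rw [key, pow_two]
  refine Ideal.add_mem _ (Ideal.mul_mem_mul hχ hf) (Ideal.sum_mem _ fun i _ =>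
    Ideal.mul_mem_mul (coordSection_mem x _) ?_)
  rw [mem_vanishingIdeal, SmoothFun.sub_apply, SmoothFun.algebraMap_apply, ← hd]
  show bumpPullback x (h i) x - _ = 0
  rw [bumpPullback, (bump n x).eq_one, one_smul, sub_self]

end VanishingIdeal

/-! ### Fields and functions that are smooth near a point -/

section Fields

open Filter Topology

variable {n : ℕ} {M : Type*} [TopologicalSpace M] [ChartedSpace (EuclideanSpace ℝ (Fin n)) M]

/-- The vector field `X` is smooth on a neighbourhood of `x`. -/
def SmoothFieldNear [IsManifold (𝓡 n) ∞ M] (X : ∀ x : M, TangentSpace (𝓡 n) x) (x : M) : Prop :=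
  ∀ᶠ y in 𝓝 x, ContMDiffAt (𝓡 n) ((𝓡 n).prod 𝓘(ℝ, EuclideanSpace ℝ (Fin n))) ∞
    (fun z => (⟨z, X z⟩ : TangentBundle (𝓡 n) M)) y

variable (n) in
/-- The function `f` is smooth on a neighbourhood of `x`. -/
def SmoothNear {V : Type*} [NormedAddCommGroup V] [NormedSpace ℝ V] (f : M → V) (x : M) : Prop :=
  ∀ᶠ y in 𝓝 x, ContMDiffAt (𝓡 n) 𝓘(ℝ, V) ∞ f y

variable {V : Type*} [NormedAddCommGroup V] [NormedSpace ℝ V] {f g : M → V} {x : M}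

theorem SmoothNear.eventually (h : SmoothNear n f x) : ∀ᶠ y in 𝓝 x, SmoothNear n f y :=
  eventually_eventually_nhds.2 h

theorem SmoothNear.contMDiffAt (h : SmoothNear n f x) : ContMDiffAt (𝓡 n) 𝓘(ℝ, V) ∞ f x :=
  h.self_of_nhds

theorem SmoothNear.mdifferentiableAt (h : SmoothNear n f x) :
    MDifferentiableAt (𝓡 n) 𝓘(ℝ, V) f x :=
  h.contMDiffAt.mdifferentiableAt (by simp)

theorem SmoothNear.congr (h : SmoothNear n f x) (e : g =ᶠ[𝓝 x] f) : SmoothNear n g x := by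
  filter_upwards [h, e.eventuallyEq_nhds] with y hy hy' using hy.congr_of_eventuallyEq hy'

theorem smoothNear_of_contMDiff (h : ContMDiff (𝓡 n) 𝓘(ℝ, V) ∞ f) (x : M) : SmoothNear n f x :=
  Eventually.of_forall fun y => h y

theorem smoothNear_const (c : V) (x : M) : SmoothNear n (fun _ : M => c) x :=
  Eventually.of_forall fun _ => contMDiffAt_const

theorem SmoothNear.add (hf : SmoothNear n f x) (hg : SmoothNear n g x) :
    SmoothNear n (fun y => f y + g y) x := by
  filter_upwards [hf, hg] with y h1 h2 using h1.add h2

theorem SmoothNear.sub (hf : SmoothNear n f x) (hg : SmoothNear n g x) :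
    SmoothNear n (fun y => f y - g y) x := by
  filter_upwards [hf, hg] with y h1 h2 using h1.sub h2

theorem SmoothNear.sum {ι : Type*} {s : Finset ι} {F : ι → M → V}
    (hF : ∀ i ∈ s, SmoothNear n (F i) x) : SmoothNear n (fun y => ∑ i ∈ s, F i y) x := by
  have : ∀ᶠ y in 𝓝 x, ∀ i ∈ s, ContMDiffAt (𝓡 n) 𝓘(ℝ, V) ∞ (F i) y :=
    (eventually_all_finset s).2 hF
  filter_upwards [this] with y hy using ContMDiffAt.sum hy

theorem contMDiffAt_mul {f g : M → ℂ} (hf : ContMDiffAt (𝓡 n) 𝓘(ℝ, ℂ) ∞ f x)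
    (hg : ContMDiffAt (𝓡 n) 𝓘(ℝ, ℂ) ∞ g x) :
    ContMDiffAt (𝓡 n) 𝓘(ℝ, ℂ) ∞ (fun y => f y * g y) x := by
  have h : ContDiff ℝ ∞ (fun z : ℂ × ℂ => z.1 * z.2) := contDiff_fst.mul contDiff_snd
  exact h.contMDiff.contMDiffAt.comp x (hf.prodMk_space hg)

theorem SmoothNear.mul {f g : M → ℂ} (hf : SmoothNear n f x) (hg : SmoothNear n g x) :
    SmoothNear n (fun y => f y * g y) x := by
  filter_upwards [hf, hg] with y h1 h2 using contMDiffAt_mul h1 h2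

theorem SmoothNear.pow {f : M → ℂ} (hf : SmoothNear n f x) (k : ℕ) :
    SmoothNear n (fun y => f y ^ k) x := by
  induction k with
  | zero => simpa using smoothNear_const (1 : ℂ) x
  | succ k ih => simpa only [pow_succ] using ih.mul hf

theorem SmoothNear.prod {ι : Type*} {s : Finset ι} {F : ι → M → ℂ}
    (hF : ∀ i ∈ s, SmoothNear n (F i) x) : SmoothNear n (fun y => ∏ i ∈ s, F i y) x := by
  classical
  induction s using Finset.induction_on with
  | empty => simpa using smoothNear_const (1 : ℂ) x
  | insert a s ha ih =>
    simp only [Finset.prod_insert ha]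
    exact (hF a (Finset.mem_insert_self _ _)).mul
      (ih fun i hi => hF i (Finset.mem_insert_of_mem hi))

variable [IsManifold (𝓡 n) ∞ M] {X Y : ∀ x : M, TangentSpace (𝓡 n) x}

theorem SmoothFieldNear.eventually (h : SmoothFieldNear X x) :
    ∀ᶠ y in 𝓝 x, SmoothFieldNear X y :=
  eventually_eventually_nhds.2 h

theorem SmoothFieldNear.contMDiffAt (h : SmoothFieldNear X x) :
    ContMDiffAt (𝓡 n) ((𝓡 n).prod 𝓘(ℝ, EuclideanSpace ℝ (Fin n))) ∞
      (fun z => (⟨z, X z⟩ : TangentBundle (𝓡 n) M)) x :=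
  h.self_of_nhds

theorem SmoothFieldNear.mdifferentiableAt (h : SmoothFieldNear X x) :
    MDifferentiableAt (𝓡 n) ((𝓡 n).prod 𝓘(ℝ, EuclideanSpace ℝ (Fin n)))
      (fun z => (⟨z, X z⟩ : TangentBundle (𝓡 n) M)) x :=
  h.contMDiffAt.mdifferentiableAt (by simp)

theorem SmoothFieldNear.congr (h : SmoothFieldNear X x) (e : ∀ᶠ y in 𝓝 x, Y y = X y) :
    SmoothFieldNear Y x := by
  filter_upwards [h, eventually_eventually_nhds.2 e] with y hy hy'
  refine hy.congr_of_eventuallyEq ?_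
  filter_upwards [hy'] with z hz
  rw [hz]

theorem SmoothFieldNear.add (hX : SmoothFieldNear X x) (hY : SmoothFieldNear Y x) :
    SmoothFieldNear (X + Y) x := by
  filter_upwards [hX, hY] with y h1 h2 using h1.add_section h2

theorem SmoothFieldNear.smul {a : M → ℝ} (ha : SmoothNear n a x) (hX : SmoothFieldNear X x) :
    SmoothFieldNear (a • X) x := by
  filter_upwards [ha, hX] with y h1 h2 using h1.smul_section h2

theorem SmoothFieldNear.sum {ι : Type*} {s : Finset ι} {X : ι → ∀ x : M, TangentSpace (𝓡 n) x}
    (hX : ∀ i ∈ s, SmoothFieldNear (X i) x) : SmoothFieldNear (∑ i ∈ s, X i) x := by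
  have : ∀ᶠ y in 𝓝 x, ∀ i ∈ s, ContMDiffAt (𝓡 n) ((𝓡 n).prod 𝓘(ℝ, EuclideanSpace ℝ (Fin n))) ∞
      (fun z => (⟨z, X i z⟩ : TangentBundle (𝓡 n) M)) y := (eventually_all_finset s).2 hX
  filter_upwards [this] with y hy
  simpa using ContMDiffAt.sum_section hy

theorem smoothFieldNear_extend (v : TangentSpace (𝓡 n) x) :
    SmoothFieldNear (FiberBundle.extend (EuclideanSpace ℝ (Fin n)) v) x := by
  obtain ⟨s, hs, h⟩ := FiberBundle.exists_contMDiffOn_extend (k := ∞) (𝓡 n)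
    (EuclideanSpace ℝ (Fin n)) v
  filter_upwards [eventually_mem_nhds_iff.2 hs] with y hy using h.contMDiffAt hy

theorem SmoothNear.deriv (hf : SmoothNear n f x) (hX : SmoothFieldNear X x) :
    SmoothNear n (fun y => mvfderiv (𝓡 n) f y (X y)) x := by
  filter_upwards [hf, hX] with y h1 h2
  have h3 := h1.mfderiv_const (m := ∞) (by simp)
  have h4 := ContMDiffAt.clm_apply_of_inCoordinates (b₁ := fun z => z) (b₂ := f)
    (v := X) (ϕ := fun z => mfderiv (𝓡 n) 𝓘(ℝ, V) f z) (E₂ := fun z : V => TangentSpace 𝓘(ℝ, V) z)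
    h3 h2 h1
  exact (contMDiff_snd_tangentBundle_modelSpace V 𝓘(ℝ, V)).contMDiffAt.comp y h4

/-- A field that is smooth near `x` agrees near `x` with a smooth field. -/
theorem SmoothFieldNear.exists_contMDiff [T2Space M] (hX : SmoothFieldNear X x) :
    ∃ Y : ∀ x : M, TangentSpace (𝓡 n) x,
      ContMDiff (𝓡 n) ((𝓡 n).prod 𝓘(ℝ, EuclideanSpace ℝ (Fin n))) ∞
        (fun z => (⟨z, Y z⟩ : TangentBundle (𝓡 n) M)) ∧ ∀ᶠ y in 𝓝 x, Y y = X y := by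
  obtain ⟨χ, -, hχ⟩ := (SmoothBumpFunction.nhds_basis_tsupport (I := 𝓡 n) x).mem_iff.1 hX
  refine ⟨(χ : M → ℝ) • X, fun y => ?_, ?_⟩
  · by_cases hy : y ∈ tsupport χ
    · exact (χ.contMDiff y).smul_section (hχ hy)
    · have h0 : ContMDiffAt (𝓡 n) ((𝓡 n).prod 𝓘(ℝ, EuclideanSpace ℝ (Fin n))) ∞
          (fun z => (⟨z, 0⟩ : TangentBundle (𝓡 n) M)) y :=
        (Bundle.contMDiff_zeroSection ℝ (TangentSpace (𝓡 n) : M → Type)) y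
      refine h0.congr_of_eventuallyEq ?_
      filter_upwards [(isClosed_tsupport χ).isOpen_compl.mem_nhds hy] with z hz
      have : χ z = 0 := image_eq_zero_of_notMem_tsupport hz
      simp [this]
  · filter_upwards [χ.eventuallyEq_one] with y hy
    simp [hy]

variable (cov : LinearConnection n M)

theorem cov_congr {X Y : ∀ x : M, TangentSpace (𝓡 n) x} (hX : SmoothFieldNear X x)
    (h : ∀ᶠ y in 𝓝 x, Y y = X y) : cov Y x = cov X x :=
  cov.isCovariantDerivativeOnUniv.congr_of_eventuallyEq (hX.congr h).mdifferentiableAt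
    hX.mdifferentiableAt univ_mem h

/-- The smoothness of the connection is applied to a globally smooth section, so `Y` is first
replaced by one with the same germ at `x`; locality of `cov` at all nearby points transfers the
result back. -/
theorem SmoothFieldNear.covariant [T2Space M] [cov.ContMDiffCovariantDerivative ∞]
    (hX : SmoothFieldNear X x) (hY : SmoothFieldNear Y x) :
    SmoothFieldNear (fun y => cov Y y (X y)) x := by
  obtain ⟨Z, hZ, hZY⟩ := hY.exists_contMDiff
  have h1 := (CovariantDerivative.ContMDiffCovariantDerivative.contMDiff (cov := cov)
    (k := ∞)).contMDiff (σ := Z) (by simpa using hZ.contMDiffOn)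
  have h2 : SmoothFieldNear (fun y => cov Z y (X y)) x := by
    filter_upwards [hX] with y hy
    exact ((h1 y trivial).contMDiffAt univ_mem).clm_bundle_apply hy
  refine h2.congr ?_
  filter_upwards [hY.eventually, eventually_eventually_nhds.2 hZY] with y h3 h4
  rw [cov_congr cov h3 h4]

end Fields

/-! ### Tensoriality of the iterated covariant differential -/

section Tensoriality

open Filter Topology

variable {n : ℕ} {M : Type*} [TopologicalSpace M] [ChartedSpace (EuclideanSpace ℝ (Fin n)) M]
  [IsManifold (𝓡 n) ∞ M]

variable (n) in
/-- The local frame of coordinate fields of the chart at `x₀`. -/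
def coordFrame (x₀ : M) (i : Fin n) : ∀ x : M, TangentSpace (𝓡 n) x :=
  (trivializationAt (EuclideanSpace ℝ (Fin n)) (TangentSpace (𝓡 n) : M → Type) x₀).localFrame
    (EuclideanSpace.basisFun (Fin n) ℝ).toBasis i

variable (n) in
/-- The coefficients with respect to `coordFrame`. -/
def coordCoeff (x₀ : M) (i : Fin n) (x : M) : TangentSpace (𝓡 n) x →ₗ[ℝ] ℝ :=
  (trivializationAt (EuclideanSpace ℝ (Fin n)) (TangentSpace (𝓡 n) : M → Type) x₀).localFrameCoeff
    (𝓡 n) (EuclideanSpace.basisFun (Fin n) ℝ).toBasis i x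

theorem eventually_mem_baseSet (x₀ : M) : ∀ᶠ x in 𝓝 x₀, x ∈ (trivializationAt
    (EuclideanSpace ℝ (Fin n)) (TangentSpace (𝓡 n) : M → Type) x₀).baseSet :=
  (trivializationAt (EuclideanSpace ℝ (Fin n)) (TangentSpace (𝓡 n) : M → Type)
    x₀).open_baseSet.mem_nhds (FiberBundle.mem_baseSet_trivializationAt' x₀)

theorem smoothFieldNear_coordFrame (x₀ : M) (i : Fin n) :
    SmoothFieldNear (coordFrame n x₀ i) x₀ := by
  filter_upwards [eventually_mem_baseSet (n := n) x₀] with x hx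
  exact contMDiffAt_localFrame_of_mem ∞ _ _ i hx

theorem smoothNear_coordCoeff {x₀ : M} {X : ∀ x : M, TangentSpace (𝓡 n) x}
    (hX : SmoothFieldNear X x₀) (i : Fin n) :
    SmoothNear n (fun x => coordCoeff n x₀ i x (X x)) x₀ := by
  filter_upwards [eventually_mem_baseSet (n := n) x₀, hX] with x hx h
  exact contMDiffAt_localFrameCoeff (EuclideanSpace.basisFun (Fin n) ℝ).toBasis hx h i

theorem eventually_eq_sum_coordFrame (x₀ : M) :
    ∀ᶠ x in 𝓝 x₀, ∀ v : TangentSpace (𝓡 n) x,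
      v = ∑ i, coordCoeff n x₀ i x v • coordFrame n x₀ i x := by
  classical
  filter_upwards [eventually_mem_baseSet (n := n) x₀] with x hx v
  -- The frame expansion is stated for sections, so `v` is extended by zero to the other points; no
  -- regularity is required.
  have := Bundle.Trivialization.eq_sum_localFrameCoeff_smul (I := 𝓡 n)
    (b := (EuclideanSpace.basisFun (Fin n) ℝ).toBasis)
    (s := fun y => if h : y = x then h ▸ v else 0) hx
  simpa using! this

/-- A map on families of vector fields that is given by a smooth covariant tensor field. -/
structure IsTensorial {r : ℕ} (T : (Fin r → ∀ x : M, TangentSpace (𝓡 n) x) → M → ℂ) : Prop where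
  smooth : ∀ {x X}, (∀ i, SmoothFieldNear (X i) x) → SmoothNear n (T X) x
  add : ∀ {x X}, (∀ i, SmoothFieldNear (X i) x) → ∀ (j) {Y Z}, SmoothFieldNear Y x →
    SmoothFieldNear Z x → T (Function.update X j (Y + Z)) x =
      T (Function.update X j Y) x + T (Function.update X j Z) x
  smul : ∀ {x X}, (∀ i, SmoothFieldNear (X i) x) → ∀ (j) {g : M → ℝ} {Y}, SmoothNear n g x →
    SmoothFieldNear Y x → T (Function.update X j (g • Y)) x =
      (g x : ℂ) * T (Function.update X j Y) x

theorem smoothFieldNear_update {r : ℕ} {x : M} {X : Fin r → ∀ x : M, TangentSpace (𝓡 n) x}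
    (hX : ∀ i, SmoothFieldNear (X i) x) (j : Fin r) {Y : ∀ x : M, TangentSpace (𝓡 n) x}
    (hY : SmoothFieldNear Y x) (i : Fin r) : SmoothFieldNear (Function.update X j Y i) x := by
  by_cases h : i = j
  · subst h; simpa using hY
  · simpa [Function.update_of_ne h] using hX i

namespace IsTensorial

variable {r : ℕ} {T : (Fin r → ∀ x : M, TangentSpace (𝓡 n) x) → M → ℂ} (hT : IsTensorial T)
  {x : M} {X : Fin r → ∀ x : M, TangentSpace (𝓡 n) x} (hX : ∀ i, SmoothFieldNear (X i) x)
  (j : Fin r) {Y Z : ∀ x : M, TangentSpace (𝓡 n) x}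

include hT hX

/-- Locality follows from linearity over functions. The indicator `ψ` of the set where `Z = Y` is
smooth near `x`, being `1` there, and `ψ • Z = ψ • Y` everywhere. -/
theorem update_congr (hY : SmoothFieldNear Y x) (h : ∀ᶠ y in 𝓝 x, Z y = Y y) :
    T (Function.update X j Z) x = T (Function.update X j Y) x := by
  classical
  let ψ : M → ℝ := fun y => if Z y = Y y then 1 else 0
  have h1 : ψ • Z = ψ • Y := by
    funext y
    by_cases hy : Z y = Y y <;> simp [ψ, hy]
  have h2 : SmoothNear n ψ x := by
    refine (smoothNear_const (1 : ℝ) x).congr ?_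
    filter_upwards [h] with y hy
    simp [ψ, hy]
  have h3 : ψ x = 1 := by simp [ψ, h.self_of_nhds]
  have e1 := hT.smul hX j h2 (hY.congr h)
  have e2 := hT.smul hX j h2 hY
  rw [h1, e2, h3] at e1
  simpa using e1.symm

theorem update_zero : T (Function.update X j 0) x = 0 := by
  have h0 : SmoothFieldNear (0 : ∀ x : M, TangentSpace (𝓡 n) x) x := by
    simpa using SmoothFieldNear.sum (s := (∅ : Finset (Fin 0))) (x := x)
      (X := fun _ => (0 : ∀ x : M, TangentSpace (𝓡 n) x)) (by simp)
  have := hT.smul hX j (smoothNear_const (0 : ℝ) x) h0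
  have e : (fun _ : M => (0 : ℝ)) • (0 : ∀ x : M, TangentSpace (𝓡 n) x) = 0 := smul_zero _
  rw [e] at this
  simpa using this

theorem update_sum {ι : Type*} (s : Finset ι) (W : ι → ∀ x : M, TangentSpace (𝓡 n) x)
    (hW : ∀ i ∈ s, SmoothFieldNear (W i) x) :
    T (Function.update X j (∑ i ∈ s, W i)) x = ∑ i ∈ s, T (Function.update X j (W i)) x := by
  classical
  induction s using Finset.induction_on with
  | empty => simpa using hT.update_zero hX j
  | insert a s ha ih =>
    have h1 := hW a (Finset.mem_insert_self _ _)
    have h2 : ∀ i ∈ s, SmoothFieldNear (W i) x := fun i hi => hW i (Finset.mem_insert_of_mem hi)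
    rw [Finset.sum_insert ha, Finset.sum_insert ha,
      hT.add hX j h1 (SmoothFieldNear.sum h2), ih h2]

/-- Expansion in the coordinate frame with function coefficients; only their values at `x` survive,
which makes the dependence on `Y` pointwise. -/
theorem update_eq_sum (hY : SmoothFieldNear Y x) :
    T (Function.update X j Y) x =
      ∑ i, (coordCoeff n x i x (Y x) : ℂ) * T (Function.update X j (coordFrame n x i)) x := by
  have h1 : ∀ i ∈ Finset.univ, SmoothFieldNear
      ((fun y => coordCoeff n x i y (Y y)) • coordFrame n x i) x := fun i _ =>
    SmoothFieldNear.smul (smoothNear_coordCoeff hY i) (smoothFieldNear_coordFrame x i)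
  rw [hT.update_congr hX j (SmoothFieldNear.sum h1) (Z := Y), hT.update_sum hX j _ _ h1]
  · refine Finset.sum_congr rfl fun i _ => ?_
    rw [hT.smul hX j (smoothNear_coordCoeff hY i) (smoothFieldNear_coordFrame x i)]
  · filter_upwards [eventually_eq_sum_coordFrame (n := n) x] with y hy
    simpa using hy (Y y)

theorem update_pointwise (hY : SmoothFieldNear Y x) (hZ : SmoothFieldNear Z x) (h : Y x = Z x) :
    T (Function.update X j Y) x = T (Function.update X j Z) x := by
  rw [hT.update_eq_sum hX j hY, hT.update_eq_sum hX j hZ, h]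

theorem pointwise {X' : Fin r → ∀ x : M, TangentSpace (𝓡 n) x}
    (hX' : ∀ i, SmoothFieldNear (X' i) x) (h : ∀ i, X i x = X' i x) : T X x = T X' x := by
  classical
  have key : ∀ s : Finset (Fin r), T (s.piecewise X' X) x = T X x := by
    intro s
    induction s using Finset.induction_on with
    | empty => simp
    | insert a s ha ih =>
      have hs : ∀ i, SmoothFieldNear (s.piecewise X' X i) x := by
        intro i
        by_cases hi : i ∈ s <;> simp [hi, hX, hX']
      rw [Finset.piecewise_insert, ← ih, hT.update_pointwise hs a (hX' a) (hX a) (h a).symm]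
      congr 1
      rw [Function.update_eq_self_iff]
      simp [ha]
  rw [← key Finset.univ]
  simp

end IsTensorial

/-! ### Sum and product rules for derivatives along a vector -/

section Derivation

variable {x : M}

theorem mvfderiv_congr_apply {f g : M → ℂ} (h : f =ᶠ[𝓝 x] g) (v : TangentSpace (𝓡 n) x) :
    mvfderiv (𝓡 n) f x v = mvfderiv (𝓡 n) g x v := by
  have h1 := h.mfderiv_eq (I := 𝓡 n) (I' := 𝓘(ℝ, ℂ))
  simp only [mvfderiv, h1]
  rfl

theorem mvfderiv_add_apply {f g : M → ℂ} (hf : SmoothNear n f x) (hg : SmoothNear n g x)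
    (v : TangentSpace (𝓡 n) x) : mvfderiv (𝓡 n) (fun y => f y + g y) x v =
      mvfderiv (𝓡 n) f x v + mvfderiv (𝓡 n) g x v := by
  have := mvfderiv_add hf.mdifferentiableAt hg.mdifferentiableAt
  exact congrArg (fun L => L v) this

theorem mvfderiv_real_mul_apply {a : M → ℝ} {f : M → ℂ} (ha : SmoothNear n a x)
    (hf : SmoothNear n f x) (v : TangentSpace (𝓡 n) x) :
    mvfderiv (𝓡 n) (fun y => (a y : ℂ) * f y) x v =
      (a x : ℂ) * mvfderiv (𝓡 n) f x v + (mvfderiv (𝓡 n) a x v : ℝ) * f x := by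
  have := congrArg (fun L => L v) (mvfderiv_smul ha.mdifferentiableAt hf.mdifferentiableAt)
  simpa [Pi.smul_def'] using! this

end Derivation

variable [T2Space M] (cov : LinearConnection n M) [cov.ContMDiffCovariantDerivative ∞]

/-- The step in the recursive definition of the iterated covariant differential. -/
def covStep {r : ℕ} (T : (Fin r → ∀ x : M, TangentSpace (𝓡 n) x) → M → ℂ)
    (X : Fin (r + 1) → ∀ x : M, TangentSpace (𝓡 n) x) (x : M) : ℂ :=
  mvfderiv (𝓡 n) (T (Fin.tail X)) x (X 0 x) -
    ∑ j : Fin r, T (Function.update (Fin.tail X) j (fun y => cov (X j.succ) y (X 0 y))) x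

theorem cov_add_eventually {x : M} {Y Z : ∀ x : M, TangentSpace (𝓡 n) x}
    (X : ∀ x : M, TangentSpace (𝓡 n) x) (hY : SmoothFieldNear Y x) (hZ : SmoothFieldNear Z x) :
    ∀ᶠ y in 𝓝 x, cov (Y + Z) y (X y) =
      ((fun y => cov Y y (X y)) + (fun y => cov Z y (X y)) : ∀ x : M, TangentSpace (𝓡 n) x) y := by
  filter_upwards [hY.eventually, hZ.eventually] with y h1 h2
  rw [cov.isCovariantDerivativeOnUniv.add h1.mdifferentiableAt h2.mdifferentiableAt]
  rfl

theorem cov_smul_eventually {x : M} {g : M → ℝ} {Y : ∀ x : M, TangentSpace (𝓡 n) x}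
    (X : ∀ x : M, TangentSpace (𝓡 n) x) (hg : SmoothNear n g x) (hY : SmoothFieldNear Y x) :
    ∀ᶠ y in 𝓝 x, cov (g • Y) y (X y) =
      (g • (fun y => cov Y y (X y)) + (fun y => mvfderiv (𝓡 n) g y (X y)) • Y :
        ∀ x : M, TangentSpace (𝓡 n) x) y := by
  filter_upwards [hY.eventually, hg.eventually] with y h1 h2
  rw [cov.isCovariantDerivativeOnUniv.leibniz h1.mdifferentiableAt h2.mdifferentiableAt]
  rfl

/-- The slot of `X 0` is linear over functions because derivatives and `cov` are so in their
direction. In another slot, replacing `Y` by `g • Y` makes the leading derivative produce `X₀(g)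
T(…, Y, …)`, and the Leibniz rule for `cov` produces the same term with the opposite sign. -/
theorem IsTensorial.covStep {r : ℕ} {T : (Fin r → ∀ x : M, TangentSpace (𝓡 n) x) → M → ℂ}
    (hT : IsTensorial T) : IsTensorial (covStep cov T) where
  smooth {x X} hX := by
    have ht : ∀ i, SmoothFieldNear (Fin.tail X i) x := fun i => hX i.succ
    refine ((hT.smooth ht).deriv (hX 0)).sub (SmoothNear.sum fun j _ => hT.smooth ?_)
    exact smoothFieldNear_update ht j ((hX 0).covariant cov (hX j.succ))
  add {x X} hX j Y Z hY hZ := by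
    have ht : ∀ i, SmoothFieldNear (Fin.tail X i) x := fun i => hX i.succ
    refine Fin.cases ?_ (fun i => ?_) j
    · simp only [Quantization.covStep, Fin.tail_update_zero, Function.update_self, ne_eq,
        Fin.succ_ne_zero,
        not_false_eq_true, Function.update_of_ne, Pi.add_apply, map_add]
      have : ∀ k : Fin r, T (Function.update (Fin.tail X) k
          (fun y => cov (X k.succ) y (Y y) + cov (X k.succ) y (Z y))) x =
          T (Function.update (Fin.tail X) k (fun y => cov (X k.succ) y (Y y))) x +
          T (Function.update (Fin.tail X) k (fun y => cov (X k.succ) y (Z y))) x := fun k =>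
        hT.add ht k (hY.covariant cov (hX k.succ)) (hZ.covariant cov (hX k.succ))
      simp only [this, Finset.sum_add_distrib]
      ring
    · have h0 : ∀ W, Function.update X i.succ W 0 = X 0 := fun W =>
        Function.update_of_ne (Fin.succ_ne_zero i).symm _ _
      simp only [Quantization.covStep, Fin.tail_update_succ, h0]
      have hd : mvfderiv (𝓡 n) (T (Function.update (Fin.tail X) i (Y + Z))) x (X 0 x) =
          mvfderiv (𝓡 n) (T (Function.update (Fin.tail X) i Y)) x (X 0 x) +
          mvfderiv (𝓡 n) (T (Function.update (Fin.tail X) i Z)) x (X 0 x) := by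
        rw [← mvfderiv_add_apply (hT.smooth (smoothFieldNear_update ht i hY))
          (hT.smooth (smoothFieldNear_update ht i hZ))]
        refine mvfderiv_congr_apply ?_ _
        filter_upwards [eventually_all.2 fun k => (ht k).eventually, hY.eventually,
          hZ.eventually] with y h1 h2 h3
        exact hT.add h1 i h2 h3
      have hs : ∀ k : Fin r, T (Function.update (Function.update (Fin.tail X) i (Y + Z)) k
            (fun y => cov (Function.update X i.succ (Y + Z) k.succ) y (X 0 y))) x =
          T (Function.update (Function.update (Fin.tail X) i Y) k
            (fun y => cov (Function.update X i.succ Y k.succ) y (X 0 y))) x +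
          T (Function.update (Function.update (Fin.tail X) i Z) k
            (fun y => cov (Function.update X i.succ Z k.succ) y (X 0 y))) x := by
        intro k
        by_cases hk : k = i
        · subst hk
          simp only [Function.update_self, Function.update_idem]
          have hcY := (hX 0).covariant cov hY
          have hcZ := (hX 0).covariant cov hZ
          rw [hT.update_congr ht k (hcY.add hcZ) (cov_add_eventually cov (X 0) hY hZ),
            hT.add ht k hcY hcZ]
        · have hk' : k.succ ≠ i.succ := fun h => hk (Fin.succ_injective _ h)
          simp only [Function.update_of_ne hk']
          rw [Function.update_comm (Ne.symm hk), Function.update_comm (Ne.symm hk),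
            Function.update_comm (Ne.symm hk),
            hT.add (smoothFieldNear_update ht k ((hX 0).covariant cov (hX k.succ))) i hY hZ]
      rw [hd]
      simp only [hs, Finset.sum_add_distrib]
      ring
  smul {x X} hX j g Y hg hY := by
    have ht : ∀ i, SmoothFieldNear (Fin.tail X i) x := fun i => hX i.succ
    refine Fin.cases ?_ (fun i => ?_) j
    · simp only [Quantization.covStep, Fin.tail_update_zero, Function.update_self, ne_eq,
        Fin.succ_ne_zero,
        not_false_eq_true, Function.update_of_ne, Pi.smul_apply', map_smul]
      have : ∀ k : Fin r, T (Function.update (Fin.tail X) k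
          (fun y => g y • cov (X k.succ) y (Y y))) x =
          (g x : ℂ) * T (Function.update (Fin.tail X) k (fun y => cov (X k.succ) y (Y y))) x :=
        fun k => hT.smul ht k hg (hY.covariant cov (hX k.succ))
      simp only [this, ← Finset.mul_sum, Complex.real_smul]
      ring
    · have h0 : ∀ W, Function.update X i.succ W 0 = X 0 := fun W =>
        Function.update_of_ne (Fin.succ_ne_zero i).symm _ _
      simp only [Quantization.covStep, Fin.tail_update_succ, h0]
      have hd : mvfderiv (𝓡 n) (T (Function.update (Fin.tail X) i (g • Y))) x (X 0 x) =
          (g x : ℂ) * mvfderiv (𝓡 n) (T (Function.update (Fin.tail X) i Y)) x (X 0 x) +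
          (mvfderiv (𝓡 n) g x (X 0 x) : ℝ) * T (Function.update (Fin.tail X) i Y) x := by
        rw [← mvfderiv_real_mul_apply hg (hT.smooth (smoothFieldNear_update ht i hY))]
        refine mvfderiv_congr_apply ?_ _
        filter_upwards [eventually_all.2 fun k => (ht k).eventually, hY.eventually,
          hg.eventually] with y h1 h2 h3
        exact hT.smul h1 i h3 h2
      -- The Leibniz term arises only when the slot being differentiated is the one that contains `g
      -- • Y`, hence the case `k = i`.
      have hs : ∀ k : Fin r, T (Function.update (Function.update (Fin.tail X) i (g • Y)) k
            (fun y => cov (Function.update X i.succ (g • Y) k.succ) y (X 0 y))) x =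
          (g x : ℂ) * T (Function.update (Function.update (Fin.tail X) i Y) k
            (fun y => cov (Function.update X i.succ Y k.succ) y (X 0 y))) x +
          if k = i then (mvfderiv (𝓡 n) g x (X 0 x) : ℝ) * T (Function.update (Fin.tail X) i Y) x
            else 0 := by
        intro k
        by_cases hk : k = i
        · subst hk
          simp only [Function.update_self, Function.update_idem, if_true]
          have hcY := (hX 0).covariant cov hY
          have hgX := hg.deriv (hX 0)
          rw [hT.update_congr ht k ((SmoothFieldNear.smul hg hcY).add (SmoothFieldNear.smul hgX hY))
            (cov_smul_eventually cov (X 0) hg hY),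
            hT.add ht k (SmoothFieldNear.smul hg hcY) (SmoothFieldNear.smul hgX hY),
            hT.smul ht k hg hcY, hT.smul ht k hgX hY]
        · have hk' : k.succ ≠ i.succ := fun h => hk (Fin.succ_injective _ h)
          simp only [Function.update_of_ne hk', if_neg hk, add_zero]
          rw [Function.update_comm (Ne.symm hk), Function.update_comm (Ne.symm hk),
            hT.smul (smoothFieldNear_update ht k ((hX 0).covariant cov (hX k.succ))) i hg hY]
      rw [hd]
      simp only [hs, Finset.sum_add_distrib, ← Finset.mul_sum, Finset.sum_ite_eq', Finset.mem_univ,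
        if_true]
      ring

/-- The iterated covariant differential is a smooth covariant tensor field. -/
theorem isTensorial_iteratedCov {f : M → ℂ} (hf : ContMDiff (𝓡 n) 𝓘(ℝ, ℂ) ∞ f) (r : ℕ) :
    IsTensorial (iteratedCov cov f r) := by
  induction r with
  | zero => exact ⟨fun _ => smoothNear_of_contMDiff hf _, fun _ j => j.elim0, fun _ j => j.elim0⟩
  | succ r ih => exact ih.covStep cov

end Tensoriality

/-! ### The contraction of a contravariant tensor field with `∇^r f` -/

section Contraction

open Filter Topology

variable {n : ℕ} {M : Type*} [TopologicalSpace M] [ChartedSpace (EuclideanSpace ℝ (Fin n)) M]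
  [IsManifold (𝓡 n) ∞ M]

theorem eq_sum_dualBasis {x : M} (ξ : Cotangent n M x) :
    ξ = ∑ i, ξ (tangentBasis x i) • dualBasis x i := by
  refine ContinuousLinearMap.coe_injective ((tangentBasis x).ext fun j => ?_)
  show ξ (tangentBasis x j) = (∑ i, ξ (tangentBasis x i) • dualBasis x i : Cotangent n M x)
    (tangentBasis x j)
  rw [sum_apply, Finset.sum_eq_single j]
  · have : dualBasis x j (tangentBasis x j) = (1 : ℝ) := by
      show (tangentBasis x).coord j (tangentBasis x j) = 1
      simp
    rw [smul_apply, this]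
    exact (mul_one _).symm
  · intro i _ hij
    have : dualBasis x i (tangentBasis x j) = (0 : ℝ) := by
      show (tangentBasis x).coord i (tangentBasis x j) = 0
      simp [hij.symm]
    rw [smul_apply, this]
    exact mul_zero _
  · simp

variable (n) in
/-- The `i`-th coordinate of the chart at `x₀`, cut off to a function on `M`. -/
def coordFun (x₀ : M) (i : Fin n) : M → ℝ :=
  bumpPullback x₀ fun u : EuclideanSpace ℝ (Fin n) => u i

theorem contMDiff_coordFun [T2Space M] (x₀ : M) (i : Fin n) :
    ContMDiff (𝓡 n) 𝓘(ℝ, ℝ) ∞ (coordFun n x₀ i) :=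
  contMDiff_bumpPullback x₀ (EuclideanSpace.proj i : EuclideanSpace ℝ (Fin n) →L[ℝ] ℝ).contDiff

/-- Near `x₀` the cut-off coordinates are the true ones, so their differentials are the coframe dual
to `coordFrame`. As differentials of global functions they can be inserted in the smoothness
condition of `symTensor`. -/
theorem eventually_differential_coordFun (x₀ : M) :
    ∀ᶠ x in 𝓝 x₀, ∀ (i : Fin n) (v : TangentSpace (𝓡 n) x),
      differential n (coordFun n x₀ i) x v = coordCoeff n x₀ i x v := by
  classical
  have h1 : ∀ᶠ x in 𝓝 x₀, ∀ i : Fin n, coordFun n x₀ i =ᶠ[𝓝 x]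
      fun y => extChartAt (𝓡 n) x₀ y i :=
    eventually_all.2 fun i => eventually_eventually_nhds.2 (bumpPullback_eventuallyEq x₀ _)
  filter_upwards [h1, eventually_mem_baseSet (n := n) x₀] with x hx hb i v
  have hs : x ∈ (chartAt (EuclideanSpace ℝ (Fin n)) x₀).source := hb
  have e1 : differential n (coordFun n x₀ i) x v = mvfderiv (𝓡 n) (coordFun n x₀ i) x v := rfl
  let pr : EuclideanSpace ℝ (Fin n) →L[ℝ] ℝ := EuclideanSpace.proj i
  rw [e1, mvfderiv_congr (hx i)]
  have e2 := mvfderiv_comp_extChartAt x₀ pr.differentiable hs v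
  rw [pr.fderiv] at e2
  refine e2.trans ?_
  have e3 := Bundle.Trivialization.localFrameCoeff_eq_coeff (I := 𝓡 n)
    (b := (EuclideanSpace.basisFun (Fin n) ℝ).toBasis) (i := i)
    (trivializationAt (EuclideanSpace ℝ (Fin n)) (TangentSpace (𝓡 n) : M → Type) x₀)
    (s := fun y => if h : y = x then h ▸ v else 0) hb
  have e4 : coordCoeff n x₀ i x v = ((EuclideanSpace.basisFun (Fin n) ℝ).toBasis.repr
    (trivializationAt (EuclideanSpace ℝ (Fin n)) (TangentSpace (𝓡 n) : M → Type)
      x₀ ⟨x, v⟩).2) i := by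
    simpa using! e3
  have e5 : (trivializationAt (EuclideanSpace ℝ (Fin n)) (TangentSpace (𝓡 n) : M → Type)
      x₀).continuousLinearMapAt ℝ x v = (trivializationAt (EuclideanSpace ℝ (Fin n))
        (TangentSpace (𝓡 n) : M → Type) x₀ ⟨x, v⟩).2 := by
    rw [Bundle.Trivialization.continuousLinearMapAt_apply,
      Bundle.Trivialization.linearMapAt_apply, if_pos hb]
  rw [e4, ← e5, TangentBundle.continuousLinearMapAt_trivializationAt hs]
  simp [pr]
  rfl

/-- Permuting the arguments of `∇^r f` amounts to reindexing the sum and permuting those of `A`,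
which is symmetric; the `r!` equal terms cancel the normalization. -/
theorem contraction_symCovAt {r : ℕ} {x : M}
    (A : MultilinearMap ℝ (fun _ : Fin r => Cotangent n M x) ℂ)
    (hA : ∀ (σ : Equiv.Perm (Fin r)) (ξ : Fin r → Cotangent n M x), A (fun i => ξ (σ i)) = A ξ)
    (cov : LinearConnection n M) (f : M → ℂ) :
    contraction A (symCovAt cov f r x) = contraction A (iteratedCovAt cov f r x) := by
  have h : ∀ σ : Equiv.Perm (Fin r), ∑ i : Fin r → Fin n, A (fun k => dualBasis x (i k)) *
      iteratedCovAt cov f r x (fun k => tangentBasis x (i (σ k))) =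
      contraction A (iteratedCovAt cov f r x) := by
    intro σ
    refine Fintype.sum_equiv (σ.symm.arrowCongr (Equiv.refl _)) _ _ fun i => ?_
    simp only [Equiv.arrowCongr_apply, Equiv.symm_symm, Equiv.coe_refl, Function.comp_apply, id]
    rw [← hA σ fun k => dualBasis x (i k)]
  have e : contraction A (symCovAt cov f r x) = (r.factorial : ℂ)⁻¹ *
      ∑ σ : Equiv.Perm (Fin r), ∑ i : Fin r → Fin n, A (fun k => dualBasis x (i k)) *
        iteratedCovAt cov f r x (fun k => tangentBasis x (i (σ k))) := by
    rw [Finset.sum_comm, Finset.mul_sum]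
    refine Finset.sum_congr rfl fun i _ => ?_
    rw [symCovAt, Finset.mul_sum, Finset.mul_sum, Finset.mul_sum]
    exact Finset.sum_congr rfl fun σ _ => by ring
  rw [e]
  simp only [h, Finset.sum_const, Finset.card_univ, Fintype.card_perm, Fintype.card_fin,
    nsmul_eq_mul]
  rw [inv_mul_cancel_left₀ (by exact_mod_cast r.factorial_ne_zero)]

variable [T2Space M] (cov : LinearConnection n M) [cov.ContMDiffCovariantDerivative ∞]

theorem iteratedCovAt_eq {f : M → ℂ} (hf : ContMDiff (𝓡 n) 𝓘(ℝ, ℂ) ∞ f) {r : ℕ} {x : M}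
    {X : Fin r → ∀ x : M, TangentSpace (𝓡 n) x} (hX : ∀ i, SmoothFieldNear (X i) x) :
    iteratedCovAt cov f r x (fun i => X i x) = iteratedCov cov f r X x :=
  (isTensorial_iteratedCov cov hf r).pointwise (fun i => smoothFieldNear_extend (X i x)) hX
    fun i => FiberBundle.extend_apply_self _ (X i x)

/-- The tensor `∇^r f` at `x` as multilinear map. -/
def covTensor {f : M → ℂ} (hf : ContMDiff (𝓡 n) 𝓘(ℝ, ℂ) ∞ f) (r : ℕ) (x : M) :
    MultilinearMap ℝ (fun _ : Fin r => TangentSpace (𝓡 n) x) ℂ where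
  toFun v := iteratedCovAt cov f r x v
  map_update_add' {dec} v j a b := by
    obtain rfl : dec = instDecidableEqFin r := Subsingleton.elim _ _
    have h : ∀ i, SmoothFieldNear (FiberBundle.extend (EuclideanSpace ℝ (Fin n)) (v i)) x :=
      fun i => smoothFieldNear_extend (v i)
    have hT := isTensorial_iteratedCov cov hf r
    have e : ∀ c : TangentSpace (𝓡 n) x, (fun i => FiberBundle.extend (EuclideanSpace ℝ (Fin n))
        (Function.update v j c i)) = Function.update (fun i => FiberBundle.extend
          (EuclideanSpace ℝ (Fin n)) (v i)) j
            (FiberBundle.extend (EuclideanSpace ℝ (Fin n)) c) := by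
      intro c
      funext i
      by_cases hi : i = j
      · subst hi; simp
      · simp [hi]
    show iteratedCov cov f r (fun i => FiberBundle.extend (EuclideanSpace ℝ (Fin n))
        (Function.update v j (a + b) i)) x = iteratedCov cov f r (fun i => FiberBundle.extend
        (EuclideanSpace ℝ (Fin n)) (Function.update v j a i)) x + iteratedCov cov f r
        (fun i => FiberBundle.extend (EuclideanSpace ℝ (Fin n)) (Function.update v j b i)) x
    rw [e, e, e, ← hT.add h j (smoothFieldNear_extend a) (smoothFieldNear_extend b)]
    -- Only the values at `x` matter, so it suffices that the extension of `a + b` and the sum of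
    -- the extensions agree there.
    exact hT.update_pointwise h j (smoothFieldNear_extend _)
      ((smoothFieldNear_extend a).add (smoothFieldNear_extend b)) (by simp)
  map_update_smul' {dec} v j c a := by
    obtain rfl : dec = instDecidableEqFin r := Subsingleton.elim _ _
    have h : ∀ i, SmoothFieldNear (FiberBundle.extend (EuclideanSpace ℝ (Fin n)) (v i)) x :=
      fun i => smoothFieldNear_extend (v i)
    have hT := isTensorial_iteratedCov cov hf r
    have e : ∀ c : TangentSpace (𝓡 n) x, (fun i => FiberBundle.extend (EuclideanSpace ℝ (Fin n))
        (Function.update v j c i)) = Function.update (fun i => FiberBundle.extend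
          (EuclideanSpace ℝ (Fin n)) (v i)) j
            (FiberBundle.extend (EuclideanSpace ℝ (Fin n)) c) := by
      intro c
      funext i
      by_cases hi : i = j
      · subst hi; simp
      · simp [hi]
    have hc : SmoothNear n (fun _ : M => c) x := smoothNear_const c x
    show iteratedCov cov f r (fun i => FiberBundle.extend (EuclideanSpace ℝ (Fin n))
        (Function.update v j (c • a) i)) x = c • iteratedCov cov f r (fun i => FiberBundle.extend
        (EuclideanSpace ℝ (Fin n)) (Function.update v j a i)) x
    rw [e, e, Complex.real_smul,
      ← hT.smul h j hc (smoothFieldNear_extend a)]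
    exact hT.update_pointwise h j (smoothFieldNear_extend _)
      (SmoothFieldNear.smul hc (smoothFieldNear_extend a)) (by simp)

/-- The basis in `contraction` comes from the preferred chart at each point and need not vary
continuously. Near `x₀` the contraction is rewritten in the fixed coordinate frame of the chart at
`x₀`, where smoothness can be seen. -/
theorem contraction_eventuallyEq {f : M → ℂ} (hf : ContMDiff (𝓡 n) 𝓘(ℝ, ℂ) ∞ f) {r : ℕ}
    (A : ∀ x : M, MultilinearMap ℝ (fun _ : Fin r => Cotangent n M x) ℂ) (x₀ : M) :
    ∀ᶠ x in 𝓝 x₀, contraction (A x) (iteratedCovAt cov f r x) =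
      ∑ K : Fin r → Fin n, A x (fun l => differential n (coordFun n x₀ (K l)) x) *
        iteratedCov cov f r (fun l => coordFrame n x₀ (K l)) x := by
  filter_upwards [eventually_differential_coordFun (n := n) x₀,
    eventually_eq_sum_coordFrame (n := n) x₀,
    eventually_all.2 fun i => (smoothFieldNear_coordFrame (n := n) x₀ i).eventually] with x h1 h2 h3
  have := sum_mul_basis_change (A x) (covTensor cov hf r x) (tangentBasis x) (dualBasis x)
    (fun k => coordFrame n x₀ k x) (fun k => differential n (coordFun n x₀ k) x)
    (fun k i => coordCoeff n x₀ k x (tangentBasis x i)) (fun k => ?_) (fun i => h2 _)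
  · refine this.trans (Finset.sum_congr rfl fun K _ => ?_)
    congr 1
    exact iteratedCovAt_eq cov hf fun i => h3 (K i)
  · rw [eq_sum_dualBasis (differential n (coordFun n x₀ k) x)]
    simp only [h1]

theorem contMDiff_contraction {f : M → ℂ} (hf : ContMDiff (𝓡 n) 𝓘(ℝ, ℂ) ∞ f) {r : ℕ}
    (A : symTensor n M r) :
    ContMDiff (𝓡 n) 𝓘(ℝ, ℂ) ∞ (fun x => contraction (A.1 x) (symCovAt cov f r x)) := by
  intro x₀
  have h : SmoothNear n (fun x => ∑ K : Fin r → Fin n,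
      A.1 x (fun l => differential n (coordFun n x₀ (K l)) x) *
        iteratedCov cov f r (fun l => coordFrame n x₀ (K l)) x) x₀ := by
    refine SmoothNear.sum fun K _ => SmoothNear.mul ?_ ?_
    · exact smoothNear_of_contMDiff (A.2.2 _ fun i => contMDiff_coordFun x₀ (K i)) x₀
    · exact (isTensorial_iteratedCov cov hf r).smooth fun i => smoothFieldNear_coordFrame x₀ (K i)
  refine h.contMDiffAt.congr_of_eventuallyEq ?_
  filter_upwards [contraction_eventuallyEq cov hf A.1 x₀] with x hx
  rw [contraction_symCovAt _ (A.2.1 x), hx]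

end Contraction

/-! ### Iterated covariant differentials of powers -/

section Powers

open Filter Topology

variable {n : ℕ} {M : Type*} [TopologicalSpace M] [ChartedSpace (EuclideanSpace ℝ (Fin n)) M]
  [IsManifold (𝓡 n) ∞ M]

theorem mvfderiv_mul_apply {x : M} {f g : M → ℂ} (hf : SmoothNear n f x) (hg : SmoothNear n g x)
    (v : TangentSpace (𝓡 n) x) : mvfderiv (𝓡 n) (fun y => f y * g y) x v =
      f x * mvfderiv (𝓡 n) g x v + mvfderiv (𝓡 n) f x v * g x := by
  have h := (hf.mdifferentiableAt.hasMFDerivAt.mul hg.mdifferentiableAt.hasMFDerivAt).mfderiv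
  have h1 : mvfderiv (𝓡 n) (fun y => f y * g y) x v = mfderiv (𝓡 n) 𝓘(ℝ, ℂ) (f * g) x v := rfl
  rw [h1, h]
  show f x * mvfderiv (𝓡 n) g x v + g x * mvfderiv (𝓡 n) f x v = _
  rw [mul_comm (g x)]

theorem mvfderiv_const_apply {x : M} (c : ℂ) (v : TangentSpace (𝓡 n) x) :
    mvfderiv (𝓡 n) (fun _ : M => c) x v = 0 := by
  rw [mvfderiv_const]; rfl

theorem mvfderiv_const_mul_apply {x : M} (c : ℂ) {f : M → ℂ} (hf : SmoothNear n f x)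
    (v : TangentSpace (𝓡 n) x) : mvfderiv (𝓡 n) (fun y => c * f y) x v =
      c * mvfderiv (𝓡 n) f x v := by
  rw [mvfderiv_mul_apply (smoothNear_const c x) hf, mvfderiv_const_apply, zero_mul, add_zero]

theorem mvfderiv_pow_apply {x : M} {f : M → ℂ} (hf : SmoothNear n f x) (m : ℕ)
    (v : TangentSpace (𝓡 n) x) : mvfderiv (𝓡 n) (fun y => f y ^ (m + 1)) x v =
      (m + 1) * f x ^ m * mvfderiv (𝓡 n) f x v := by
  induction m with
  | zero => simp
  | succ m ih =>
    have : (fun y => f y ^ (m + 1 + 1)) = fun y => f y * f y ^ (m + 1) := by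
      funext y; ring
    rw [this, mvfderiv_mul_apply hf (hf.pow _), ih]
    push_cast
    ring

variable [T2Space M] (cov : LinearConnection n M) [cov.ContMDiffCovariantDerivative ∞]

theorem iteratedCov_add {f g : M → ℂ} (hf : ContMDiff (𝓡 n) 𝓘(ℝ, ℂ) ∞ f)
    (hg : ContMDiff (𝓡 n) 𝓘(ℝ, ℂ) ∞ g) (r : ℕ) : ∀ {x : M}
    {X : Fin r → ∀ x : M, TangentSpace (𝓡 n) x}, (∀ i, SmoothFieldNear (X i) x) →
    iteratedCov cov (fun y => f y + g y) r X x =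
      iteratedCov cov f r X x + iteratedCov cov g r X x := by
  induction r with
  | zero => intro x X _; rfl
  | succ r ih =>
    intro x X hX
    have ht : ∀ i, SmoothFieldNear (Fin.tail X i) x := fun i => hX i.succ
    simp only [iteratedCov]
    have hd : mvfderiv (𝓡 n) (iteratedCov cov (fun y => f y + g y) r (Fin.tail X)) x (X 0 x) =
        mvfderiv (𝓡 n) (iteratedCov cov f r (Fin.tail X)) x (X 0 x) +
        mvfderiv (𝓡 n) (iteratedCov cov g r (Fin.tail X)) x (X 0 x) := by
      rw [← mvfderiv_add_apply ((isTensorial_iteratedCov cov hf r).smooth ht)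
        ((isTensorial_iteratedCov cov hg r).smooth ht)]
      refine mvfderiv_congr_apply ?_ _
      filter_upwards [eventually_all.2 fun k => (ht k).eventually] with y h1 using ih h1
    have hs : ∀ j : Fin r, iteratedCov cov (fun y => f y + g y) r
          (Function.update (Fin.tail X) j (fun y => cov (X j.succ) y (X 0 y))) x =
        iteratedCov cov f r
          (Function.update (Fin.tail X) j (fun y => cov (X j.succ) y (X 0 y))) x +
        iteratedCov cov g r
          (Function.update (Fin.tail X) j (fun y => cov (X j.succ) y (X 0 y))) x := fun j =>
      ih (smoothFieldNear_update ht j ((hX 0).covariant cov (hX j.succ)))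
    rw [hd]
    simp only [hs, Finset.sum_add_distrib]
    ring

theorem iteratedCov_const_mul (c : ℂ) {f : M → ℂ} (hf : ContMDiff (𝓡 n) 𝓘(ℝ, ℂ) ∞ f) (r : ℕ) :
    ∀ {x : M} {X : Fin r → ∀ x : M, TangentSpace (𝓡 n) x}, (∀ i, SmoothFieldNear (X i) x) →
    iteratedCov cov (fun y => c * f y) r X x = c * iteratedCov cov f r X x := by
  induction r with
  | zero => intro x X _; rfl
  | succ r ih =>
    intro x X hX
    have ht : ∀ i, SmoothFieldNear (Fin.tail X i) x := fun i => hX i.succ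
    simp only [iteratedCov]
    have hd : mvfderiv (𝓡 n) (iteratedCov cov (fun y => c * f y) r (Fin.tail X)) x (X 0 x) =
        c * mvfderiv (𝓡 n) (iteratedCov cov f r (Fin.tail X)) x (X 0 x) := by
      rw [← mvfderiv_const_mul_apply c ((isTensorial_iteratedCov cov hf r).smooth ht)]
      refine mvfderiv_congr_apply ?_ _
      filter_upwards [eventually_all.2 fun k => (ht k).eventually] with y h1 using ih h1
    have hs : ∀ j : Fin r, iteratedCov cov (fun y => c * f y) r
          (Function.update (Fin.tail X) j (fun y => cov (X j.succ) y (X 0 y))) x =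
        c * iteratedCov cov f r
          (Function.update (Fin.tail X) j (fun y => cov (X j.succ) y (X 0 y))) x := fun j =>
      ih (smoothFieldNear_update ht j ((hX 0).covariant cov (hX j.succ)))
    rw [hd]
    simp only [hs, ← Finset.mul_sum]
    ring

/-- The covariant differential of order `k` of a power `g ^ (k + m)`, up to multiples of
`g ^ (m + 1)`. -/
theorem exists_iteratedCov_pow {g : M → ℂ} (hg : ContMDiff (𝓡 n) 𝓘(ℝ, ℂ) ∞ g) (k : ℕ) :
    ∀ (m : ℕ) {x : M} {X : Fin k → ∀ x : M, TangentSpace (𝓡 n) x},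
      (∀ i, SmoothFieldNear (X i) x) → ∃ h : M → ℂ, SmoothNear n h x ∧
        iteratedCov cov (fun y => g y ^ (k + m)) k X =ᶠ[𝓝 x] fun y =>
          ((k + m).descFactorial k : ℂ) * (g y ^ m * ∏ i, mvfderiv (𝓡 n) g y (X i y)) +
            g y ^ (m + 1) * h y := by
  induction k with
  | zero =>
    intro m x X _
    refine ⟨fun _ => 0, smoothNear_const 0 x, Eventually.of_forall fun y => ?_⟩
    simp [iteratedCov]
  | succ k ih =>
    intro m x X hX
    have ht : ∀ i, SmoothFieldNear (Fin.tail X i) x := fun i => hX i.succ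
    have hu : ∀ j, ∀ i, SmoothFieldNear
        (Function.update (Fin.tail X) j (fun y => cov (X j.succ) y (X 0 y)) i) x := fun j =>
      smoothFieldNear_update ht j ((hX 0).covariant cov (hX j.succ))
    have hgx : SmoothNear n g x := smoothNear_of_contMDiff hg x
    -- Since `k + 1 + m = k + (m + 1)`, the hypothesis is needed for one more spare factor of `g`.
    obtain ⟨h, hh, e⟩ := ih (m + 1) ht
    choose h' hh' e' using fun j => ih (m + 1) (hu j)
    have hPi : ∀ {Z : Fin k → ∀ x : M, TangentSpace (𝓡 n) x}, (∀ i, SmoothFieldNear (Z i) x) →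
        SmoothNear n (fun y => ∏ i, mvfderiv (𝓡 n) g y (Z i y)) x := fun hZ =>
      SmoothNear.prod fun i _ => hgx.deriv (hZ i)
    have hpow : k + 1 + m = k + (m + 1) := by ring
    let C : ℂ := ((k + (m + 1)).descFactorial k : ℂ)
    -- Only differentiating the explicit `g ^ (m + 1)` lowers its exponent to `m`, and this gives
    -- the leading term with factor `m + 1`. Everything else, including the connection terms, keeps
    -- `g ^ (m + 1)`; the witness collects the cofactors.
    refine ⟨fun y => C *
        mvfderiv (𝓡 n) (fun y => ∏ i, mvfderiv (𝓡 n) g y (Fin.tail X i y)) y (X 0 y)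
        + ((m + 1 : ℕ) + 1) * (mvfderiv (𝓡 n) g y (X 0 y) * h y)
        + g y * mvfderiv (𝓡 n) h y (X 0 y)
        - ∑ j, (C * ∏ i, mvfderiv (𝓡 n) g y
            (Function.update (Fin.tail X) j (fun y => cov (X j.succ) y (X 0 y)) i y)
          + g y * h' j y), ?_, ?_⟩
    · refine SmoothNear.sub (((((smoothNear_const C x).mul ((hPi ht).deriv (hX 0))).add
        ((smoothNear_const _ x).mul ((hgx.deriv (hX 0)).mul hh)))).add
          (hgx.mul (hh.deriv (hX 0)))) (SmoothNear.sum fun j _ => ?_)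
      exact ((smoothNear_const C x).mul (hPi (hu j))).add (hgx.mul (hh' j))
    · filter_upwards [e.eventuallyEq_nhds, eventually_all.2 e', (hPi ht).eventually,
        hh.eventually] with y hy hy' hP hhy
      have hgy : SmoothNear n g y := smoothNear_of_contMDiff hg y
      rw [hpow]
      simp only [iteratedCov]
      rw [mvfderiv_congr_apply hy, mvfderiv_add_apply ((smoothNear_const C y).mul
        ((hgy.pow _).mul hP)) ((hgy.pow _).mul hhy), mvfderiv_const_mul_apply _
        ((hgy.pow _).mul hP), mvfderiv_mul_apply (hgy.pow _) hP, mvfderiv_mul_apply (hgy.pow _) hhy,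
        mvfderiv_pow_apply hgy, mvfderiv_pow_apply hgy]
      simp only [hy']
      have hC : ((k + (m + 1)).descFactorial (k + 1) : ℂ) = (m + 1) * C := by
        rw [Nat.descFactorial_succ]
        have : k + (m + 1) - k = m + 1 := by omega
        rw [this]
        push_cast
        rfl
      have hs : ∑ j : Fin k, (C * (g y ^ (m + 1) * ∏ i, mvfderiv (𝓡 n) g y
            (Function.update (Fin.tail X) j (fun y => cov (X j.succ) y (X 0 y)) i y)) +
            g y ^ (m + 1 + 1) * h' j y) = g y ^ (m + 1) * ∑ j : Fin k, (C * ∏ i, mvfderiv (𝓡 n) g y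
            (Function.update (Fin.tail X) j (fun y => cov (X j.succ) y (X 0 y)) i y) +
            g y * h' j y) := by
        rw [Finset.mul_sum]
        exact Finset.sum_congr rfl fun j _ => by ring
      have hp : ∏ i, mvfderiv (𝓡 n) g y (X i y) = mvfderiv (𝓡 n) g y (X 0 y) *
          ∏ i, mvfderiv (𝓡 n) g y (Fin.tail X i y) := Fin.prod_univ_succ _
      rw [hs, hC, hp]
      push_cast
      ring

/-- The surplus exponent `s - k` is positive, so both terms of `exists_iteratedCov_pow` contain a
factor `g x = 0`. With no surplus the leading term remains, with coefficient `k!`. -/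
theorem iteratedCovAt_pow_of_lt {g : SmoothFun n M} {x : M} (hg : g ∈ vanishingIdeal n x)
    {k s : ℕ} (hks : k < s) (v : Fin k → TangentSpace (𝓡 n) x) :
    iteratedCovAt cov ((g ^ s : SmoothFun n M) : M → ℂ) k x v = 0 := by
  obtain ⟨m, rfl⟩ := Nat.exists_eq_add_of_lt hks
  have hg0 : g x = 0 := hg
  obtain ⟨h, -, e⟩ := exists_iteratedCov_pow cov g.contMDiff k (m + 1)
    (fun i => smoothFieldNear_extend (v i))
  have hfun : ((g ^ (k + m + 1) : SmoothFun n M) : M → ℂ) = fun y => g y ^ (k + (m + 1)) := by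
    funext y
    exact SmoothFun.pow_apply g _ y
  rw [iteratedCovAt, hfun, e.self_of_nhds]
  beta_reduce
  rw [hg0]
  simp

theorem iteratedCovAt_pow_self {g : SmoothFun n M} {x : M} (hg : g ∈ vanishingIdeal n x)
    {k : ℕ} (v : Fin k → TangentSpace (𝓡 n) x) :
    iteratedCovAt cov ((g ^ k : SmoothFun n M) : M → ℂ) k x v =
      (k.factorial : ℂ) * ∏ i, mvfderiv (𝓡 n) (g : M → ℂ) x (v i) := by
  have hg0 : g x = 0 := hg
  obtain ⟨h, -, e⟩ := exists_iteratedCov_pow cov g.contMDiff k 0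
    (fun i => smoothFieldNear_extend (v i))
  have hfun : ((g ^ k : SmoothFun n M) : M → ℂ) = fun y => g y ^ (k + 0) := by
    funext y
    exact SmoothFun.pow_apply g _ y
  rw [iteratedCovAt, hfun, e.self_of_nhds]
  beta_reduce
  rw [hg0]
  simp [Nat.descFactorial_self]

end Powers

/-! ### Quantization and differential operators -/

section Quantize

open Filter Topology

variable {n : ℕ} {M : Type*} [TopologicalSpace M] [ChartedSpace (EuclideanSpace ℝ (Fin n)) M]
  [IsManifold (𝓡 n) ∞ M]

theorem symTensor_add_apply {r : ℕ} (A B : symTensor n M r) (x : M)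
    (ξ : Fin r → Cotangent n M x) : (A + B).1 x ξ = A.1 x ξ + B.1 x ξ := rfl

theorem symTensor_smul_apply {r : ℕ} (c : ℂ) (A : symTensor n M r) (x : M)
    (ξ : Fin r → Cotangent n M x) : (c • A).1 x ξ = c * A.1 x ξ := rfl

theorem symTensor_ext {r : ℕ} {A B : symTensor n M r}
    (h : ∀ (x : M) (ξ : Fin r → Cotangent n M x), A.1 x ξ = B.1 x ξ) : A = B :=
  Subtype.ext (funext fun x => MultilinearMap.ext (h x))

/-- A symmetric tensor field vanishes if its values on the diagonal do. -/
theorem symTensor_eq_zero {r : ℕ} {A : symTensor n M r}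
    (h : ∀ (x : M) (ξ : Cotangent n M x), A.1 x (fun _ => ξ) = 0) : A = 0 :=
  symTensor_ext fun x ξ => eq_zero_of_diagonal_eq_zero (A.1 x) (A.2.1 x) (h x) ξ

variable [T2Space M] (cov : LinearConnection n M) [cov.ContMDiffCovariantDerivative ∞] (ħ : ℝ)

/-- The functional `f ↦ ⟨A, ∇^r_sym f⟩(x)`. -/
def contractionFunctional {r : ℕ} (A : symTensor n M r) (x : M) : SmoothFun n M →ₗ[ℂ] ℂ where
  toFun f := contraction (A.1 x) (symCovAt cov f r x)
  map_add' f g := by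
    rw [contraction_symCovAt _ (A.2.1 x), contraction_symCovAt _ (A.2.1 x),
      contraction_symCovAt _ (A.2.1 x), contraction, contraction, contraction,
      ← Finset.sum_add_distrib]
    refine Finset.sum_congr rfl fun i _ => ?_
    rw [← mul_add]
    congr 1
    exact iteratedCov_add cov f.contMDiff g.contMDiff r fun _ => smoothFieldNear_extend _
  map_smul' c f := by
    rw [contraction_symCovAt _ (A.2.1 x), contraction_symCovAt _ (A.2.1 x), contraction,
      contraction, RingHom.id_apply, smul_eq_mul, Finset.mul_sum]
    refine Finset.sum_congr rfl fun i _ => ?_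
    rw [mul_left_comm]
    congr 1
    exact iteratedCov_const_mul cov c f.contMDiff r fun _ => smoothFieldNear_extend _

theorem contractionFunctional_apply {r : ℕ} (A : symTensor n M r) (x : M) (f : SmoothFun n M) :
    contractionFunctional cov A x f = contraction (A.1 x) (symCovAt cov f r x) := rfl

/-- The quantized of a homogeneous tensor field. -/
def quantizeHom (r : ℕ) : symTensor n M r →ₗ[ℂ] SmoothFun n M →ₗ[ℂ] SmoothFun n M :=
  LinearMap.mk₂ ℂ (fun A f => SmoothFun.mk
      (fun x => (-Complex.I * ħ) ^ r * contraction (A.1 x) (symCovAt cov f r x))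
      ((smoothFunctions n M).smul_mem (contMDiff_contraction cov f.contMDiff A)
        ((-Complex.I * ħ) ^ r)))
    (fun A B f => SmoothFun.ext fun x => by
      simp only [SmoothFun.add_apply, SmoothFun.mk_apply, contraction, symTensor_add_apply,
        add_mul, Finset.sum_add_distrib, mul_add])
    (fun c A f => SmoothFun.ext fun x => by
      simp only [SmoothFun.smul_apply, SmoothFun.mk_apply, contraction, symTensor_smul_apply]
      rw [mul_left_comm c, Finset.mul_sum _ _ c]
      simp only [mul_assoc])
    (fun A f g => SmoothFun.ext fun x => by
      simp only [SmoothFun.add_apply, SmoothFun.mk_apply, ← contractionFunctional_apply, map_add,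
        mul_add])
    (fun c A f => SmoothFun.ext fun x => by
      simp only [SmoothFun.smul_apply, SmoothFun.mk_apply, ← contractionFunctional_apply, map_smul,
        smul_eq_mul, mul_left_comm])

theorem quantizeHom_apply {r : ℕ} (A : symTensor n M r) (f : SmoothFun n M) (x : M) :
    quantizeHom cov ħ r A f x = (-Complex.I * ħ) ^ r * contractionFunctional cov A x f := rfl

/-- The quantized of a tensor field. -/
def quantize : SymTensor n M →ₗ[ℂ] SmoothFun n M →ₗ[ℂ] SmoothFun n M :=
  DFinsupp.lsum ℂ (quantizeHom cov ħ)

open Classical in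
theorem quantize_eq_sum (Φ : SymTensor n M) :
    quantize cov ħ Φ = ∑ r ∈ Φ.support, quantizeHom cov ħ r (Φ r) := by
  show DFinsupp.sumAddHom _ Φ = _
  rw [DFinsupp.sumAddHom_apply]
  rfl

theorem isQuantized_iff (Φ : SymTensor n M) (P : SmoothFun n M →ₗ[ℂ] SmoothFun n M) :
    IsQuantized ħ cov Φ P ↔ P = quantize cov ħ Φ := by
  classical
  have h : ∀ (f : SmoothFun n M) (x : M), quantize cov ħ Φ f x =
      ∑ r ∈ Φ.support, (-Complex.I * ħ) ^ r * contraction ((Φ r).1 x) (symCovAt cov f r x) := by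
    intro f x
    rw [quantize_eq_sum, LinearMap.sum_apply, SmoothFun.sum_apply]
    rfl
  constructor
  · intro hP
    refine LinearMap.ext fun f => SmoothFun.ext fun x => ?_
    rw [h, hP f x]
  · rintro rfl f x
    rw [h]

theorem contractionFunctional_pow_of_lt {r s : ℕ} (hrs : r < s) (A : symTensor n M r) {x : M}
    {g : SmoothFun n M} (hg : g ∈ vanishingIdeal n x) :
    contractionFunctional cov A x (g ^ s) = 0 := by
  rw [contractionFunctional_apply, contraction_symCovAt _ (A.2.1 x), contraction]
  simp only [iteratedCovAt_pow_of_lt cov hg hrs, mul_zero, Finset.sum_const_zero]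

theorem contractionFunctional_pow_self {r : ℕ} (A : symTensor n M r) {x : M}
    {g : SmoothFun n M} (hg : g ∈ vanishingIdeal n x) :
    contractionFunctional cov A x (g ^ r) = (r.factorial : ℂ) * ∑ i : Fin r → Fin n,
      A.1 x (fun k => dualBasis x (i k)) *
        ∏ k, mvfderiv (𝓡 n) (g : M → ℂ) x (tangentBasis x (i k)) := by
  rw [contractionFunctional_apply, contraction_symCovAt _ (A.2.1 x), contraction, Finset.mul_sum]
  refine Finset.sum_congr rfl fun i _ => ?_
  rw [iteratedCovAt_pow_self cov hg]
  ring

theorem quantizeHom_mem {r s : ℕ} (hrs : r < s) (A : symTensor n M r) {x : M} {f : SmoothFun n M}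
    (hf : f ∈ vanishingIdeal n x ^ s) : quantizeHom cov ħ r A f ∈ vanishingIdeal n x := by
  obtain ⟨t, rfl⟩ : ∃ t, s = t + 1 := ⟨s - 1, by omega⟩
  rw [mem_vanishingIdeal, quantizeHom_apply, linear_eq_zero_of_mem_pow_succ (vanishingIdeal n x)
    (contractionFunctional cov A x) t (fun g hg => contractionFunctional_pow_of_lt cov hrs A hg) f
    hf, mul_zero]

theorem quantize_mem_diffOp (Φ : SymTensor n M) : quantize cov ħ Φ ∈ diffOp n M := by
  classical
  rw [quantize_eq_sum]
  exact Submodule.sum_mem _ fun r _ =>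
    ⟨r, fun x f hf => quantizeHom_mem cov ħ (Nat.lt_succ_self r) _ hf⟩

/-- The test functions `coordSection n x ξ ^ r` read off the diagonal values of `A`. -/
theorem contractionFunctional_coordSection {r : ℕ} (A : symTensor n M r) (x : M)
    (ξ : Cotangent n M x) : contractionFunctional cov A x (coordSection n x ξ ^ r) =
      (r.factorial : ℂ) * A.1 x (fun _ => ξ) := by
  rw [contractionFunctional_pow_self cov A (coordSection_mem x ξ)]
  congr 1
  conv_rhs => rw [eq_sum_dualBasis ξ, MultilinearMap.map_sum]
  refine Finset.sum_congr rfl fun i _ => ?_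
  rw [MultilinearMap.map_smul_univ, Complex.real_smul, mul_comm]
  congr 1
  simp only [mvfderiv_coordSection, Complex.ofReal_prod]

/-- On `coordSection n x ξ ^ r`, with `r` the top degree of `Φ`, all lower components vanish at `x`.
What remains is a nonzero multiple of `Φ_r(ξ, …, ξ)`, and diagonal values determine `Φ_r`. -/
theorem quantize_injective (hħ : ħ ≠ 0) : Function.Injective (quantize (M := M) cov ħ) := by
  classical
  rw [← LinearMap.ker_eq_bot, LinearMap.ker_eq_bot']
  intro Φ hΦ
  by_contra hne
  have hs : Φ.support.Nonempty := by
    rw [Finset.nonempty_iff_ne_empty, ne_eq, DFinsupp.support_eq_empty]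
    exact hne
  set r := Φ.support.max' hs with hr
  have hmem : r ∈ Φ.support := Finset.max'_mem _ hs
  refine (DFinsupp.mem_support_iff.1 hmem) (symTensor_eq_zero fun x ξ => ?_)
  have h1 : quantize cov ħ Φ (coordSection n x ξ ^ r) x = 0 := by rw [hΦ]; rfl
  rw [quantize_eq_sum, LinearMap.sum_apply, SmoothFun.sum_apply, Finset.sum_eq_single r] at h1
  · rw [quantizeHom_apply, contractionFunctional_coordSection] at h1
    have hc : (-Complex.I * (ħ : ℂ)) ^ r ≠ 0 := pow_ne_zero _ (by simp [hħ])
    exact (mul_eq_zero.1 ((mul_eq_zero.1 h1).resolve_left hc)).resolve_left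
      (by exact_mod_cast r.factorial_ne_zero)
  · intro k hk hkr
    have : k < r := lt_of_le_of_ne (Finset.le_max' _ k hk) hkr
    rw [quantizeHom_apply, contractionFunctional_pow_of_lt cov this _ (coordSection_mem x ξ),
      mul_zero]
  · exact fun h => absurd hmem h

/-! ### The principal symbol of a differential operator -/

section Symbol

variable {P : SmoothFun n M →ₗ[ℂ] SmoothFun n M} {r : ℕ}
  (hP : ∀ x : M, ∀ f ∈ vanishingIdeal n x ^ (r + 1), P f ∈ vanishingIdeal n x)

/-- The principal symbol of `P` at `x`, multiplied by `c`. -/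
def symbolForm (P : SmoothFun n M →ₗ[ℂ] SmoothFun n M) (r : ℕ) (c : ℂ) (x : M) :
    MultilinearMap ℝ (fun _ : Fin r => Cotangent n M x) ℂ :=
  ((c • (SmoothFun.eval x).toLinearMap ∘ₗ P).restrictScalars ℝ).compMultilinearMap
    ((MultilinearMap.mkPiAlgebra ℝ (Fin r) (SmoothFun n M)).compLinearMap
      fun _ => coordSection n x)

theorem symbolForm_apply (P : SmoothFun n M →ₗ[ℂ] SmoothFun n M) (c : ℂ) (x : M)
    (ξ : Fin r → Cotangent n M x) :
    symbolForm P r c x ξ = c * P (∏ i, coordSection n x (ξ i)) x := rfl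

/-- Modulo `𝔪_x ^ 2`, the section built from the chart at `x` may be replaced by `f - f(x)`, which
varies with `x` only through a constant. -/
theorem coordSection_differential_sub_mem {f : M → ℝ} (hf : ContMDiff (𝓡 n) 𝓘(ℝ, ℝ) ∞ f) (x : M) :
    coordSection n x (differential n f x) - (SmoothFun.ofReal f hf -
      algebraMap ℂ (SmoothFun n M) (f x)) ∈ vanishingIdeal n x ^ 2 := by
  have h := sub_sum_coordSection_mem x (SmoothFun.ofReal f hf - algebraMap ℂ (SmoothFun n M) (f x))
    (sub_algebraMap_mem x (SmoothFun.ofReal f hf))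
  have hd : ∀ v, mvfderiv (𝓡 n) ((SmoothFun.ofReal f hf - algebraMap ℂ (SmoothFun n M) (f x) :
      SmoothFun n M) : M → ℂ) x v = ((differential n f x v : ℝ) : ℂ) := by
    intro v
    have e : ((SmoothFun.ofReal f hf - algebraMap ℂ (SmoothFun n M) (f x) :
      SmoothFun n M) : M → ℂ) = fun y => (SmoothFun.ofReal f hf : M → ℂ) y + -(f x : ℂ) := by
      funext y
      exact sub_eq_add_neg _ _
    rw [e, mvfderiv_add_apply (smoothNear_of_contMDiff (SmoothFun.contMDiff _) x)
      (smoothNear_const _ x), mvfderiv_const_apply, add_zero]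
    exact mvfderiv_ofReal_apply ((hf x).mdifferentiableAt (by simp)) v
  have hs : coordSection n x (differential n f x) = ∑ i,
      ((differential n f x (tangentBasis x i) : ℝ) : ℂ) • coordSection n x (dualBasis x i) := by
    conv_lhs => rw [eq_sum_dualBasis (differential n f x), map_sum]
    refine Finset.sum_congr rfl fun i _ => ?_
    rw [map_smul]
    rfl
  simp only [hd] at h
  rw [← hs] at h
  have := neg_mem h
  rwa [neg_sub] at this

include hP

theorem apply_prod_congr {x : M} (a b : Fin r → SmoothFun n M)
    (ha : ∀ i, a i ∈ vanishingIdeal n x) (hb : ∀ i, b i ∈ vanishingIdeal n x)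
    (hab : ∀ i, a i - b i ∈ vanishingIdeal n x ^ 2) : P (∏ i, a i) x = P (∏ i, b i) x := by
  have h := hP x _ (prod_sub_prod_mem (vanishingIdeal n x) a b ha hb hab)
  rw [mem_vanishingIdeal, map_sub, SmoothFun.sub_apply] at h
  exact sub_eq_zero.1 h

/-- With the factors replaced by `f_i - f_i(x)`, the product expands over subsets and the constants
leave `P` by linearity. The result is a polynomial expression in the functions `F i` and `P (∏ i ∈
t, F i)`, all smooth; no local form of `P` is needed. -/
theorem contMDiff_symbolForm (c : ℂ) (f : Fin r → M → ℝ)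
    (hf : ∀ i, ContMDiff (𝓡 n) 𝓘(ℝ, ℝ) ∞ (f i)) :
    ContMDiff (𝓡 n) 𝓘(ℝ, ℂ) ∞ (fun x => symbolForm P r c x fun i => differential n (f i) x) := by
  classical
  let F : Fin r → SmoothFun n M := fun i => SmoothFun.ofReal (f i) (hf i)
  have e : (fun x => symbolForm P r c x fun i => differential n (f i) x) =
      ((c • ∑ t ∈ (Finset.univ : Finset (Fin r)).powerset,
        (∏ i ∈ Finset.univ \ t, -F i) * P (∏ i ∈ t, F i) : SmoothFun n M) : M → ℂ) := by
    funext x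
    rw [symbolForm_apply,
      apply_prod_congr hP _ (fun i => F i + algebraMap ℂ (SmoothFun n M) (-F i x))
      (fun i => coordSection_mem x _) (fun i => ?_) (fun i => ?_), Finset.prod_add, map_sum,
      SmoothFun.sum_apply, SmoothFun.smul_apply, SmoothFun.sum_apply]
    · congr 1
      refine Finset.sum_congr rfl fun t _ => ?_
      rw [← map_prod, mul_comm, ← Algebra.smul_def, map_smul, SmoothFun.smul_apply,
        SmoothFun.mul_apply, SmoothFun.prod_apply]
      rfl
    · rw [map_neg, ← sub_eq_add_neg]
      exact sub_algebraMap_mem x _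
    · rw [map_neg, ← sub_eq_add_neg]
      exact coordSection_differential_sub_mem (hf i) x
  rw [e]
  exact SmoothFun.contMDiff _

/-- The principal symbol of `P`, multiplied by `c`. -/
def symbol (c : ℂ) : symTensor n M r :=
  ⟨symbolForm P r c, fun x σ ξ => by
    rw [symbolForm_apply, symbolForm_apply,
      Equiv.prod_comp σ fun i => coordSection n x (ξ i)], contMDiff_symbolForm hP c⟩

/-- Subtraction of the quantized principal symbol lowers the order. -/
theorem sub_quantizeHom_symbol_mem (hħ : ħ ≠ 0) (x : M) (f : SmoothFun n M)
    (hf : f ∈ vanishingIdeal n x ^ r) :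
    (P - quantizeHom cov ħ r (symbol hP ((-Complex.I * ħ) ^ r * r.factorial)⁻¹)) f ∈
      vanishingIdeal n x := by
  have hc : (-Complex.I * (ħ : ℂ)) ^ r ≠ 0 := pow_ne_zero _ (by simp [hħ])
  have hr : (r.factorial : ℂ) ≠ 0 := by exact_mod_cast r.factorial_ne_zero
  set A := symbol hP ((-Complex.I * ħ) ^ r * r.factorial)⁻¹ with hA
  set Q := P - quantizeHom cov ħ r A
  let L : SmoothFun n M →ₗ[ℂ] ℂ := (SmoothFun.eval x).toLinearMap ∘ₗ Q
  have hL : ∀ f, L f = P f x - (-Complex.I * ħ) ^ r * contractionFunctional cov A x f :=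
    fun f => rfl
  -- It suffices to check powers `g ^ r`, where the symbols agree, and `𝔪_x ^ (r + 1)`, which both
  -- operators send into `𝔪_x`.
  refine linear_eq_zero_of_mem_pow (vanishingIdeal n x)
    (fun a => ⟨a x, sub_algebraMap_mem x a⟩) L r (fun g hg => ?_) (fun f hf => ?_) f hf
  · have hd := sub_sum_coordSection_mem x g hg
    have hm : ∑ i, mvfderiv (𝓡 n) (g : M → ℂ) x (tangentBasis x i) •
        coordSection n x (dualBasis x i) ∈ vanishingIdeal n x :=
      Submodule.sum_mem _ fun i _ =>
        ((vanishingIdeal n x).restrictScalars ℂ).smul_mem _ (coordSection_mem x _)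
    -- The function `g` is replaced by its linear part, with complex coefficients. Expanding the
    -- power then involves only products of coordinate sections, on which the symbol is defined.
    have h1 : P (g ^ r) x = P ((∑ i, mvfderiv (𝓡 n) (g : M → ℂ) x (tangentBasis x i) •
        coordSection n x (dualBasis x i)) ^ r) x := by
      simpa using apply_prod_congr hP (fun _ => g) (fun _ => _) (fun _ => hg) (fun _ => hm)
        fun _ => hd
    have h2 : (∑ i, mvfderiv (𝓡 n) (g : M → ℂ) x (tangentBasis x i) •
        coordSection n x (dualBasis x i)) ^ r = ∑ I : Fin r → Fin n,
        (∏ k, mvfderiv (𝓡 n) (g : M → ℂ) x (tangentBasis x (I k))) •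
          ∏ k, coordSection n x (dualBasis x (I k)) := by
      have := Finset.prod_univ_sum (fun _ : Fin r => (Finset.univ : Finset (Fin n)))
        (fun _ i => mvfderiv (𝓡 n) (g : M → ℂ) x (tangentBasis x i) •
          coordSection n x (dualBasis x i))
      rw [Finset.prod_const, Finset.card_univ, Fintype.card_fin, Fintype.piFinset_univ] at this
      rw [this]
      refine Finset.sum_congr rfl fun I _ => ?_
      simp only [Algebra.smul_def, Finset.prod_mul_distrib, map_prod]
    rw [hL, contractionFunctional_pow_self cov A hg, h1, h2, map_sum, SmoothFun.sum_apply,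
      ← mul_assoc, Finset.mul_sum, ← Finset.sum_sub_distrib]
    refine Finset.sum_eq_zero fun I _ => ?_
    have h3 : A.1 x (fun k => dualBasis x (I k)) = ((-Complex.I * ħ) ^ r * r.factorial)⁻¹ *
        P (∏ k, coordSection n x (dualBasis x (I k))) x := rfl
    have hu := mul_ne_zero hc hr
    rw [map_smul, SmoothFun.smul_apply, h3, mul_assoc (_⁻¹), mul_inv_cancel_left₀ hu]
    ring
  · have h1 : P f x = 0 := hP x f hf
    have h2 : (-Complex.I * ħ) ^ r * contractionFunctional cov A x f = 0 :=
      quantizeHom_mem cov ħ (Nat.lt_succ_self r) A hf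
    rw [hL, h1, h2, sub_zero]

end Symbol

/-- Induction on a strict bound for the order: for `r = 0` the ideal power is the whole ring and `P
= 0`; in the step, the symbol is subtracted. -/
theorem exists_quantize_eq (hħ : ħ ≠ 0) (r : ℕ) : ∀ P : SmoothFun n M →ₗ[ℂ] SmoothFun n M,
    (∀ x : M, ∀ f ∈ vanishingIdeal n x ^ r, P f ∈ vanishingIdeal n x) →
      ∃ Φ : SymTensor n M, P = quantize cov ħ Φ := by
  classical
  induction r with
  | zero =>
    intro P hP
    refine ⟨0, LinearMap.ext fun f => SmoothFun.ext fun x => ?_⟩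
    rw [map_zero]
    exact hP x f (by simp)
  | succ r ih =>
    intro P hP
    obtain ⟨Φ, hΦ⟩ := ih _ (sub_quantizeHom_symbol_mem cov ħ hP hħ)
    refine ⟨Φ + DFinsupp.single r (symbol hP ((-Complex.I * ħ) ^ r * r.factorial)⁻¹), ?_⟩
    have : quantize cov ħ (DFinsupp.single r
        (symbol hP ((-Complex.I * ħ) ^ r * r.factorial)⁻¹)) =
        quantizeHom cov ħ r (symbol hP ((-Complex.I * ħ) ^ r * r.factorial)⁻¹) :=
      DFinsupp.lsum_single _ _ _ _
    rw [map_add, ← hΦ, this, sub_add_cancel]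

/-- The differential operators are the quantized of the tensor fields. -/
theorem mem_diffOp_iff (hħ : ħ ≠ 0) (P : SmoothFun n M →ₗ[ℂ] SmoothFun n M) :
    P ∈ diffOp n M ↔ ∃ Φ : SymTensor n M, P = quantize cov ħ Φ := by
  constructor
  · rintro ⟨r, hr⟩
    exact exists_quantize_eq cov ħ hħ (r + 1) P hr
  · rintro ⟨Φ, rfl⟩
    exact quantize_mem_diffOp cov ħ Φ

theorem existsUnique_isQuantized (hħ : ħ ≠ 0) (P : diffOp n M) :
    ∃! Φ : SymTensor n M, IsQuantized ħ cov Φ P.1 := by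
  obtain ⟨Φ, hΦ⟩ := (mem_diffOp_iff cov ħ hħ P.1).1 P.2
  refine ⟨Φ, (isQuantized_iff cov ħ Φ P.1).2 hΦ, fun Ψ hΨ => quantize_injective cov ħ hħ ?_⟩
  rw [← hΦ, ← (isQuantized_iff cov ħ Ψ P.1).1 hΨ]

end Quantize

/-! ### Functions on the cotangent bundle that are polynomial along the fibres -/

section FibrePolynomial

open Filter Topology

variable {n : ℕ} {M : Type*} [TopologicalSpace M] [ChartedSpace (EuclideanSpace ℝ (Fin n)) M]
  [IsManifold (𝓡 n) ∞ M]

theorem contMDiffAt_apply_coordFrame (p₀ : CotangentBundle n M) (i : Fin n) :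
    ContMDiffAt (cotangentModel n) 𝓘(ℝ, ℝ) ∞
      (fun p : CotangentBundle n M => (p.2 (coordFrame n p₀.proj i p.proj) : ℝ)) p₀ := by
  have hp : ContMDiff (cotangentModel n) (𝓡 n) ∞
      (Bundle.TotalSpace.proj : CotangentBundle n M → M) :=
    Bundle.contMDiff_proj (Cotangent n M)
  have h1 : ContMDiffAt (cotangentModel n) ((𝓡 n).prod 𝓘(ℝ, EuclideanSpace ℝ (Fin n))) ∞
      (fun p : CotangentBundle n M =>
        (⟨p.proj, coordFrame n p₀.proj i p.proj⟩ : TangentBundle (𝓡 n) M)) p₀ :=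
    ContMDiffAt.comp p₀ (smoothFieldNear_coordFrame p₀.proj i).contMDiffAt (hp p₀)
  have h2 : ContMDiffAt (cotangentModel n) (cotangentModel n) ∞
      (fun p : CotangentBundle n M => Bundle.TotalSpace.mk' (EuclideanSpace ℝ (Fin n) →L[ℝ] ℝ)
        (E := Cotangent n M) p.proj p.2) p₀ := contMDiffAt_id
  have h3 := h2.clm_bundle_apply h1
  exact (Bundle.contMDiffAt_totalSpace.1 h3).2

theorem contMDiff_differential {g : M → ℝ} (hg : ContMDiff (𝓡 n) 𝓘(ℝ, ℝ) ∞ g) :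
    ContMDiff (𝓡 n) (cotangentModel n) ∞
      (fun x => (⟨x, differential n g x⟩ : CotangentBundle n M)) := by
  intro x₀
  refine (contMDiffAt_hom_bundle _).2 ⟨contMDiffAt_id, ?_⟩
  have h := (hg x₀).mfderiv_const (m := ∞) (by simp)
  refine h.congr_of_eventuallyEq ?_
  refine Eventually.of_forall fun x => ?_
  have h1 := Bundle.Trivial.continuousLinearMapAt_trivialization ℝ M ℝ x
  have h2 := TangentBundle.continuousLinearMapAt_model_space (𝕜 := ℝ) (g x₀) (g x)
  have e1 : ContinuousLinearMap.inCoordinates (EuclideanSpace ℝ (Fin n))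
      (TangentSpace (𝓡 n) : M → Type) ℝ (Bundle.Trivial M ℝ) x₀ x x₀ x (differential n g x) =
      (differential n g x).comp ((trivializationAt (EuclideanSpace ℝ (Fin n))
        (TangentSpace (𝓡 n) : M → Type) x₀).symmL ℝ x) := by
    ext v
    exact congrArg (fun L => L (differential n g x ((trivializationAt (EuclideanSpace ℝ (Fin n))
        (TangentSpace (𝓡 n) : M → Type) x₀).symmL ℝ x v))) h1
  refine e1.trans ?_
  ext v
  exact (congrArg (fun L => L (mfderiv (𝓡 n) 𝓘(ℝ, ℝ) g x
    ((trivializationAt (EuclideanSpace ℝ (Fin n))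
        (TangentSpace (𝓡 n) : M → Type) x₀).symmL ℝ x v))) h2).symm

theorem contMDiff_fibreHom [T2Space M] {r : ℕ} (A : symTensor n M r) :
    ContMDiff (cotangentModel n) 𝓘(ℝ, ℂ) ∞
      (fun p : CotangentBundle n M => A.1 p.proj fun _ => p.2) := by
  intro p₀
  have hp : ContMDiff (cotangentModel n) (𝓡 n) ∞
      (Bundle.TotalSpace.proj : CotangentBundle n M → M) :=
    Bundle.contMDiff_proj (Cotangent n M)
  -- Writing `p = ∑ p_i dx^i` in the chart, the function is a polynomial in the smooth fibre
  -- coordinates `p_i`, with the smooth components of `A` as coefficients.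
  have h : ContMDiffAt (cotangentModel n) 𝓘(ℝ, ℂ) ∞ (fun p : CotangentBundle n M =>
      ∑ I : Fin r → Fin n, (∏ k, p.2 (coordFrame n p₀.proj (I k) p.proj) : ℝ) •
        A.1 p.proj fun k => differential n (coordFun n p₀.proj (I k)) p.proj) p₀ := by
    refine ContMDiffAt.sum fun I _ => ?_
    have h1 : ContMDiffAt (cotangentModel n) 𝓘(ℝ, ℝ) ∞ (fun p : CotangentBundle n M =>
        (∏ k, p.2 (coordFrame n p₀.proj (I k) p.proj) : ℝ)) p₀ :=
      ContMDiffAt.prod fun k _ => contMDiffAt_apply_coordFrame p₀ (I k)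
    have h2 : ContMDiffAt (cotangentModel n) 𝓘(ℝ, ℂ) ∞ (fun p : CotangentBundle n M =>
        A.1 p.proj fun k => differential n (coordFun n p₀.proj (I k)) p.proj) p₀ :=
      ContMDiffAt.comp p₀
        (A.2.2 (fun k => coordFun n p₀.proj (I k)) (fun k => contMDiff_coordFun _ _) p₀.proj)
        (hp p₀)
    exact h1.smul h2
  refine h.congr_of_eventuallyEq ?_
  have hc : Tendsto (Bundle.TotalSpace.proj : CotangentBundle n M → M) (𝓝 p₀) (𝓝 p₀.proj) :=
    hp.continuous.continuousAt
  filter_upwards [hc.eventually (eventually_eq_sum_coordFrame (n := n) p₀.proj),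
    hc.eventually (eventually_differential_coordFun (n := n) p₀.proj)] with p h1 h2
  have e : p.2 = ∑ i, (p.2 (coordFrame n p₀.proj i p.proj) : ℝ) •
      differential n (coordFun n p₀.proj i) p.proj := by
    ext v
    conv_lhs => rw [h1 v, map_sum]
    rw [sum_apply]
    refine Finset.sum_congr rfl fun i _ => ?_
    rw [map_smul, smul_apply, h2 i v]
    exact mul_comm _ _
  conv_lhs => rw [e, MultilinearMap.map_sum]
  exact Finset.sum_congr rfl fun I _ => MultilinearMap.map_smul_univ _ _ _

end FibrePolynomial

/-! ### Tensor fields and fibrewise polynomial functions -/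

section FibreFunction

open Filter Topology

variable {n : ℕ} {M : Type*} [TopologicalSpace M] [ChartedSpace (EuclideanSpace ℝ (Fin n)) M]
  [IsManifold (𝓡 n) ∞ M]

theorem fibreFunction_eq_sum_range {Φ : SymTensor n M} {d : ℕ} (hd : ∀ k, d < k → Φ k = 0)
    (p : CotangentBundle n M) :
    fibreFunction Φ p = ∑ k ∈ Finset.range (d + 1), (Φ k).1 p.proj (fun _ => p.2) := by
  classical
  rw [fibreFunction]
  refine Finset.sum_subset_zero_on_sdiff (fun k hk => ?_) (fun k hk => ?_) fun _ _ => rfl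
  · by_contra h
    exact (DFinsupp.mem_support_iff.1 hk) (hd k (by simpa using h))
  · have : Φ k = 0 := by
      by_contra h
      exact (Finset.mem_sdiff.1 hk).2 (DFinsupp.mem_support_iff.2 h)
    rw [this]
    rfl

theorem SymTensor.exists_degree_le (Φ : SymTensor n M) : ∃ d : ℕ, ∀ k, d < k → Φ k = 0 := by
  classical
  refine ⟨Φ.support.sup id, fun k hk => ?_⟩
  by_contra h
  exact absurd (Finset.le_sup (f := id) (DFinsupp.mem_support_iff.2 h)) (not_le.2 hk)

theorem isFibrePolynomial_fibreFunction [T2Space M] (Φ : SymTensor n M) :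
    IsFibrePolynomial (fibreFunction Φ) := by
  obtain ⟨d, hd⟩ := Φ.exists_degree_le
  refine ⟨?_, d, fun x => ⟨fun k => (Φ k).1 x, fun ξ => fibreFunction_eq_sum_range hd _⟩⟩
  have e : fibreFunction Φ = fun p => ∑ k ∈ Finset.range (d + 1), (Φ k).1 p.proj (fun _ => p.2) :=
    funext (fibreFunction_eq_sum_range hd)
  rw [e]
  exact fun p => ContMDiffAt.sum fun k _ => contMDiff_fibreHom (Φ k) p

theorem fibreFunction_sub (Φ Ψ : SymTensor n M) (p : CotangentBundle n M) :
    fibreFunction (Φ - Ψ) p = fibreFunction Φ p - fibreFunction Ψ p := by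
  obtain ⟨d, hd⟩ := Φ.exists_degree_le
  obtain ⟨e, he⟩ := Ψ.exists_degree_le
  have hd' : ∀ k, max d e < k → Φ k = 0 := fun k hk => hd k (lt_of_le_of_lt (le_max_left _ _) hk)
  have he' : ∀ k, max d e < k → Ψ k = 0 := fun k hk => he k (lt_of_le_of_lt (le_max_right _ _) hk)
  rw [fibreFunction_eq_sum_range (d := max d e) (fun k hk => by
    rw [DFinsupp.sub_apply, hd' k hk, he' k hk, sub_zero]), fibreFunction_eq_sum_range hd',
    fibreFunction_eq_sum_range he', ← Finset.sum_sub_distrib]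
  rfl

theorem sum_multilinear_smul {V : Type*} [AddCommGroup V] [Module ℝ V]
    (A : ∀ k : ℕ, MultilinearMap ℝ (fun _ : Fin k => V) ℂ) (d t : ℕ) (ξ : V) :
    ∑ k ∈ Finset.range (d + 1), A k (fun _ => (t : ℝ) • ξ) =
      ∑ k ∈ Finset.range (d + 1), A k (fun _ => ξ) * (t : ℂ) ^ k := by
  refine Finset.sum_congr rfl fun k _ => ?_
  rw [(A k).map_smul_univ (fun _ => (t : ℝ)) fun _ => ξ, Finset.prod_const, Finset.card_univ,
    Fintype.card_fin, Complex.real_smul, mul_comm]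
  norm_cast

/-- Along `t • ξ` the function is a polynomial in `t` with coefficients `Φ_k(ξ, …, ξ)`, which are
recovered from its values at `t = 0, …, d`. -/
theorem eq_zero_of_fibreFunction_eq_zero {Φ : SymTensor n M} (h : ∀ p, fibreFunction Φ p = 0) :
    Φ = 0 := by
  obtain ⟨d, hd⟩ := Φ.exists_degree_le
  obtain ⟨c, hc⟩ := exists_coeff_extraction d
  refine DFinsupp.ext fun k => ?_
  by_cases hk : d < k
  · exact hd k hk
  refine symTensor_eq_zero fun x ξ => ?_
  rw [hc (fun k => (Φ k).1 x fun _ => ξ) k (by simpa using hk)]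
  refine Finset.sum_eq_zero fun t _ => ?_
  rw [← sum_multilinear_smul (fun k => (Φ k).1 x) d t ξ]
  have := h ⟨x, ((t : ℕ) : ℝ) • ξ⟩
  rw [fibreFunction_eq_sum_range hd] at this
  exact mul_eq_zero_of_right _ this

variable (n M) in
/-- The tensor field of order zero given by a constant. -/
def constTensor (c : ℂ) : symTensor n M 0 :=
  ⟨fun x => MultilinearMap.constOfIsEmpty ℝ (fun _ : Fin 0 => Cotangent n M x) c,
    fun _ _ _ => rfl, fun _ _ => contMDiff_const⟩

theorem fibreFunction_constTensor (c : ℂ) (p : CotangentBundle n M) :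
    fibreFunction (DFinsupp.single 0 (constTensor n M c)) p = c := by
  rw [fibreFunction_eq_sum_range (d := 0) fun k hk => DFinsupp.single_eq_of_ne (by omega)]
  rw [zero_add, Finset.sum_range_one, DFinsupp.single_eq_same]
  rfl

theorem quantize_constTensor [T2Space M] (cov : LinearConnection n M)
    [cov.ContMDiffCovariantDerivative ∞] (ħ : ℝ) (c : ℂ) :
    quantize cov ħ (DFinsupp.single 0 (constTensor n M c)) = c • LinearMap.id := by
  have h : quantize cov ħ (DFinsupp.single 0 (constTensor n M c)) =
      quantizeHom cov ħ 0 (constTensor n M c) := DFinsupp.lsum_single _ _ _ _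
  rw [h]
  refine LinearMap.ext fun f => SmoothFun.ext fun x => ?_
  rw [quantizeHom_apply, contractionFunctional_apply, contraction, pow_zero, one_mul,
    Fintype.sum_unique, symCovAt, Fintype.sum_unique, Nat.factorial_zero, Nat.cast_one, inv_one,
    one_mul]
  rfl

/-- The functions of two tensor fields differ by a constant if and only if the quantized
operators do. -/
theorem fibreFunction_sub_eq_const_iff [T2Space M] (cov : LinearConnection n M)
    [cov.ContMDiffCovariantDerivative ∞] {ħ : ℝ} (hħ : ħ ≠ 0) (Φ Ψ : SymTensor n M) (c : ℂ) :
    (∀ p, fibreFunction Φ p - fibreFunction Ψ p = c) ↔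
      quantize cov ħ Φ - quantize cov ħ Ψ = c • LinearMap.id := by
  rw [← quantize_constTensor cov ħ c, ← map_sub, (quantize_injective cov ħ hħ).eq_iff]
  constructor
  · intro h
    refine sub_eq_zero.1 (eq_zero_of_fibreFunction_eq_zero fun p => ?_)
    rw [fibreFunction_sub, fibreFunction_sub, fibreFunction_constTensor, h, sub_self]
  · intro h p
    rw [← fibreFunction_sub, h, fibreFunction_constTensor]

theorem sum_differential {ι : Type*} (S : Finset ι) {f : ι → M → ℝ}
    (hf : ∀ i, ContMDiff (𝓡 n) 𝓘(ℝ, ℝ) ∞ (f i)) (x : M) :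
    ∑ i ∈ S, differential n (f i) x = differential n (fun y => ∑ i ∈ S, f i y) x := by
  classical
  induction S using Finset.induction_on with
  | empty =>
    ext v
    simp only [Finset.sum_empty]
    exact (congrArg (fun L => L v) (mvfderiv_const (I := 𝓡 n) (x := x) (0 : ℝ))).symm
  | insert a S ha ih =>
    rw [Finset.sum_insert ha, ih]
    simp only [Finset.sum_insert ha]
    have hS : ContMDiff (𝓡 n) 𝓘(ℝ, ℝ) ∞ fun y => ∑ i ∈ S, f i y :=
      fun y => ContMDiffAt.sum fun i _ => hf i y
    ext v
    exact (congrArg (fun L => L v) (mvfderiv_add (I := 𝓡 n)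
      ((hf a x).mdifferentiableAt (by simp)) ((hS x).mdifferentiableAt (by simp)))).symm

theorem smul_differential (t : ℝ) {f : M → ℝ} (hf : ContMDiff (𝓡 n) 𝓘(ℝ, ℝ) ∞ f) (x : M) :
    t • differential n f x = differential n (fun y => t * f y) x := by
  ext v
  have h := congrArg (fun L => L v) (mvfderiv_smul (I := 𝓡 n) (a := fun _ : M => t) (x := x)
    mdifferentiableAt_const ((hf x).mdifferentiableAt (by simp)))
  rw [mvfderiv_const] at h
  simpa [Pi.smul_def'] using! h.symm

/-- The forms `A x k` are chosen separately at each point, so nothing is known about their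
dependence on `x`. Symmetrizing them keeps their diagonal, and the smoothness of the components is
recovered from that of `F`. -/
theorem exists_fibreFunction_eq {F : CotangentBundle n M → ℂ} (hF : IsFibrePolynomial F) :
    ∃ Φ : SymTensor n M, fibreFunction Φ = F := by
  obtain ⟨hs, d, hA⟩ := hF
  choose A hA using hA
  obtain ⟨c, hc⟩ := exists_coeff_extraction d
  let B : ∀ (k : ℕ) (x : M), MultilinearMap ℝ (fun _ : Fin k => Cotangent n M x) ℂ := fun k x =>
    (k.factorial : ℂ)⁻¹ • ∑ σ : Equiv.Perm (Fin k), (A x k).domDomCongr σ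
  have hBs : ∀ (k : ℕ) (x : M) (σ : Equiv.Perm (Fin k)) (ξ : Fin k → Cotangent n M x),
      B k x (fun i => ξ (σ i)) = B k x ξ := by
    intro k x σ ξ
    simp only [B, smul_apply, sum_apply,
      MultilinearMap.domDomCongr_apply]
    congr 1
    exact Equiv.sum_comp (Equiv.mulLeft σ) fun τ : Equiv.Perm (Fin k) => A x k fun i => ξ (τ i)
  have hBd : ∀ (k : ℕ) (x : M) (ξ : Cotangent n M x), B k x (fun _ => ξ) = A x k fun _ => ξ := by
    intro k x ξ
    simp only [B, smul_apply, sum_apply,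
      MultilinearMap.domDomCongr_apply, Finset.sum_const, Finset.card_univ, Fintype.card_perm,
      Fintype.card_fin, nsmul_eq_mul, smul_eq_mul]
    exact inv_mul_cancel_left₀ (by exact_mod_cast k.factorial_ne_zero) _
  have hBF : ∀ k ∈ Finset.range (d + 1), ∀ (x : M) (ξ : Cotangent n M x),
      B k x (fun _ => ξ) = ∑ t : Fin (d + 1), c k t * F ⟨x, ((t : ℕ) : ℝ) • ξ⟩ := by
    intro k hk x ξ
    rw [hBd, hc (fun k => A x k fun _ => ξ) k hk]
    refine Finset.sum_congr rfl fun t _ => ?_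
    rw [hA, sum_multilinear_smul (A x)]
  have hB : ∀ k ∈ Finset.range (d + 1), B k ∈ symTensor n M k := by
    refine fun k hk => ⟨hBs k, fun f hf => ?_⟩
    have h0 : (k.factorial : ℂ) ≠ 0 := by exact_mod_cast k.factorial_ne_zero
    -- Polarization reduces to diagonal values, and coefficient extraction turns these into values
    -- of `F`. The arguments are multiples of sums of differentials, hence themselves differentials,
    -- so each term is `F` composed with a smooth section of `T^*M`.
    have e : (fun x => B k x fun i => differential n (f i) x) = fun x => (k.factorial : ℂ)⁻¹ *
        ∑ S : Finset (Fin k), ∑ t : Fin (d + 1), ((-1 : ℂ) ^ Sᶜ.card * c k t) *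
          F ⟨x, differential n (fun y => ((t : ℕ) : ℝ) * ∑ i ∈ S, f i y) x⟩ := by
      funext x
      have h1 := polarization (B k x) (hBs k x) fun i => differential n (f i) x
      rw [nsmul_eq_mul] at h1
      rw [eq_inv_mul_iff_mul_eq₀ h0, ← h1]
      refine Finset.sum_congr rfl fun S _ => ?_
      have h2 : ContMDiff (𝓡 n) 𝓘(ℝ, ℝ) ∞ fun y => ∑ i ∈ S, f i y :=
        fun y => ContMDiffAt.sum fun i _ => hf i y
      rw [hBF k hk, sum_differential S hf, zsmul_eq_mul, Finset.mul_sum]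
      refine Finset.sum_congr rfl fun t _ => ?_
      rw [smul_differential _ h2]
      push_cast
      ring
    rw [e]
    refine fun x => contMDiffAt_mul contMDiffAt_const (ContMDiffAt.sum fun S _ =>
      ContMDiffAt.sum fun t _ => contMDiffAt_mul contMDiffAt_const ?_)
    have h2 : ContMDiff (𝓡 n) 𝓘(ℝ, ℝ) ∞ fun y => ((t : ℕ) : ℝ) * ∑ i ∈ S, f i y :=
      fun y => contMDiffAt_const.mul (ContMDiffAt.sum fun i _ => hf i y)
    exact ContMDiffAt.comp x (hs _) (contMDiff_differential h2 x)
  let Φ : SymTensor n M := DFinsupp.mk (Finset.range (d + 1)) fun k => ⟨B k, hB k k.2⟩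
  have hΦ : ∀ k (hk : k ∈ Finset.range (d + 1)), Φ k = ⟨B k, hB k hk⟩ := fun k hk =>
    DFinsupp.mk_of_mem hk
  refine ⟨Φ, funext fun p => ?_⟩
  rw [fibreFunction_eq_sum_range (d := d) fun k hk => DFinsupp.mk_of_notMem (by simpa using hk)]
  refine (Finset.sum_congr rfl fun k hk => ?_).trans (hA p.proj p.2).symm
  rw [hΦ k hk]
  exact hBd k p.proj p.2

end FibreFunction

/-! ### The symplectic form -/

section SymplecticForm

open Filter Topology

variable {n : ℕ} {M : Type*} [TopologicalSpace M] [ChartedSpace (EuclideanSpace ℝ (Fin n)) M]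
  [IsManifold (𝓡 n) ∞ M]

theorem extChartAt_cotangent_snd (p q : CotangentBundle n M) :
    (extChartAt (cotangentModel n) p q).2 = (q.2 : TangentSpace (𝓡 n) q.proj →L[ℝ] ℝ).comp
      ((trivializationAt (EuclideanSpace ℝ (Fin n)) (TangentSpace (𝓡 n) : M → Type)
        p.proj).symmL ℝ q.proj) := by
  rw [FiberBundle.extChartAt]
  have h1 := Bundle.Trivial.continuousLinearMapAt_trivialization ℝ M ℝ q.proj
  ext v
  exact congrArg (fun L => L (q.2 ((trivializationAt (EuclideanSpace ℝ (Fin n))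
        (TangentSpace (𝓡 n) : M → Type) p.proj).symmL ℝ q.proj v))) h1

theorem proj_extChartAt_symm (p : CotangentBundle n M) {z : CotangentModel n}
    (hz : z ∈ (extChartAt (cotangentModel n) p).target) :
    ((extChartAt (cotangentModel n) p).symm z).proj = (extChartAt (𝓡 n) p.proj).symm z.1 := by
  rw [FiberBundle.extChartAt_target] at hz
  rw [FiberBundle.extChartAt]
  exact (trivializationAt (EuclideanSpace ℝ (Fin n) →L[ℝ] ℝ) (Cotangent n M)
    p.proj).proj_symm_apply' hz.1.2

theorem mem_target_of_mem (p : CotangentBundle n M) {z : CotangentModel n}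
    (hz : z ∈ (extChartAt (cotangentModel n) p).target) :
    z.1 ∈ (extChartAt (𝓡 n) p.proj).target := by
  rw [FiberBundle.extChartAt_target] at hz
  exact hz.1.1

/-- In a cotangent chart `θ` is `p dq`: the projection becomes `Prod.fst`, and the fibre coordinate
of `q` is `q.2` composed with the inverse trivialization of the tangent bundle, which is the
derivative of the inverse base chart. -/
theorem liouville_comp_mfderiv_symm (p : CotangentBundle n M) {z : CotangentModel n}
    (hz : z ∈ (extChartAt (cotangentModel n) p).target) (w : CotangentModel n) :
    (liouville ((extChartAt (cotangentModel n) p).symm z))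
      (mfderiv 𝓘(ℝ, CotangentModel n) (cotangentModel n)
        (extChartAt (cotangentModel n) p).symm z w) = z.2 w.1 := by
  set q := (extChartAt (cotangentModel n) p).symm z with hq
  have hz1 := mem_target_of_mem p hz
  have hqp : q.proj = (extChartAt (𝓡 n) p.proj).symm z.1 := proj_extChartAt_symm p hz
  have hqs : q.proj ∈ (chartAt (EuclideanSpace ℝ (Fin n)) p.proj).source := by
    rw [hqp, ← extChartAt_source (𝓡 n)]
    exact (extChartAt (𝓡 n) p.proj).map_target hz1
  have e1 : z.2 = (q.2 : TangentSpace (𝓡 n) q.proj →L[ℝ] ℝ).comp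
      ((trivializationAt (EuclideanSpace ℝ (Fin n)) (TangentSpace (𝓡 n) : M → Type)
        p.proj).symmL ℝ q.proj) := by
    rw [← extChartAt_cotangent_snd, hq, (extChartAt (cotangentModel n) p).right_inv hz]
  have e2 : extChartAt (𝓡 n) p.proj q.proj = z.1 := by
    rw [hqp, (extChartAt (𝓡 n) p.proj).right_inv hz1]
  rw [TangentBundle.symmL_trivializationAt hqs, e2, ModelWithCorners.range_eq_univ,
    mfderivWithin_univ] at e1
  have d1 : MDifferentiableAt 𝓘(ℝ, CotangentModel n) (cotangentModel n)
      (extChartAt (cotangentModel n) p).symm z :=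
    ((contMDiffOn_extChartAt_symm (n := ∞) p).contMDiffAt
      ((isOpen_extChartAt_target p).mem_nhds hz)).mdifferentiableAt (by simp)
  have d2 : MDifferentiableAt (cotangentModel n) (𝓡 n)
      (Bundle.TotalSpace.proj : CotangentBundle n M → M) q :=
    (Bundle.contMDiff_proj (n := ∞) (Cotangent n M) q).mdifferentiableAt (by simp)
  have d3 : MDifferentiableAt 𝓘(ℝ, EuclideanSpace ℝ (Fin n)) (𝓡 n)
      (extChartAt (𝓡 n) p.proj).symm z.1 :=
    ((contMDiffOn_extChartAt_symm (n := ∞) p.proj).contMDiffAt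
      ((isOpen_extChartAt_target p.proj).mem_nhds hz1)).mdifferentiableAt (by simp)
  have d4 : MDifferentiableAt 𝓘(ℝ, CotangentModel n) 𝓘(ℝ, EuclideanSpace ℝ (Fin n))
      (Prod.fst : CotangentModel n → _) z := differentiableAt_fst.mdifferentiableAt
  have e3 : (Bundle.TotalSpace.proj : CotangentBundle n M → M) ∘
      (extChartAt (cotangentModel n) p).symm =ᶠ[𝓝 z]
        (extChartAt (𝓡 n) p.proj).symm ∘ Prod.fst := by
    filter_upwards [(isOpen_extChartAt_target p).mem_nhds hz] with y hy
    exact proj_extChartAt_symm p hy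
  have e4 := mfderiv_comp z d2 d1
  have e5 := mfderiv_comp z d3 d4
  have e6 := e3.mfderiv_eq (I := 𝓘(ℝ, CotangentModel n)) (I' := 𝓡 n)
  have e7 : mfderiv 𝓘(ℝ, CotangentModel n) 𝓘(ℝ, EuclideanSpace ℝ (Fin n))
      (Prod.fst : CotangentModel n → _) z w = w.1 := by
    rw [mfderiv_eq_fderiv, fderiv_fst]
    rfl
  have e8 : mfderiv (cotangentModel n) (𝓡 n) (Bundle.TotalSpace.proj : CotangentBundle n M → M) q
      (mfderiv 𝓘(ℝ, CotangentModel n) (cotangentModel n)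
        (extChartAt (cotangentModel n) p).symm z w) =
      mfderiv 𝓘(ℝ, EuclideanSpace ℝ (Fin n)) (𝓡 n) (extChartAt (𝓡 n) p.proj).symm z.1 w.1 :=
    (congrArg (fun L => L w) ((e4.symm.trans e6).trans e5)).trans (congrArg
      (mfderiv 𝓘(ℝ, EuclideanSpace ℝ (Fin n)) (𝓡 n) (extChartAt (𝓡 n) p.proj).symm z.1) e7)
  exact (congrArg q.2 e8).trans (congrArg (fun L => L w.1) e1).symm

/-- Near the base point the local form of `θ` is the restriction of the linear map `B`, so its
derivative is `B`; the chart at `p` has identity differential at `p`. -/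
theorem symplecticForm_apply (p : CotangentBundle n M) (v w : CotangentModel n) :
    symplecticForm p v w = v.2 w.1 - w.2 v.1 := by
  let B : CotangentModel n →L[ℝ] CotangentModel n →L[ℝ] ℝ :=
    ((ContinuousLinearMap.compL ℝ (CotangentModel n) (EuclideanSpace ℝ (Fin n)) ℝ).flip
      (ContinuousLinearMap.fst ℝ _ _)).comp (ContinuousLinearMap.snd ℝ _ _)
  have h1 : (fun z => (liouville ((extChartAt (cotangentModel n) p).symm z)).comp
      (mfderiv 𝓘(ℝ, CotangentModel n) (cotangentModel n)
        (extChartAt (cotangentModel n) p).symm z)) =ᶠ[𝓝 (extChartAt (cotangentModel n) p p)] B := by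
    filter_upwards [extChartAt_target_mem_nhds (I := cotangentModel n) p] with z hz
    exact ContinuousLinearMap.ext fun w => liouville_comp_mfderiv_symm p hz w
  have h2 := h1.fderiv_eq (𝕜 := ℝ)
  rw [B.fderiv] at h2
  have h3 := mfderiv_extChartAt_self (I := cotangentModel n) (x := p)
  have key : ∀ (A : CotangentModel n →L[ℝ] CotangentModel n →L[ℝ] ℝ)
      (φ : CotangentModel n → CotangentModel n), A = B → (∀ v, φ v = v) →
      A (φ v) (φ w) - A (φ w) (φ v) = v.2 w.1 - w.2 v.1 := by
    rintro A φ rfl hφ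
    rw [hφ, hφ]
    rfl
  exact key _ _ h2 fun v => congrArg (fun L => L v) h3

end SymplecticForm

/-! ### Hamiltonian fields -/

section ComplexTensor

variable {V : Type*} [AddCommGroup V] [Module ℝ V]

theorem exists_eq_one_tmul_add_I_tmul (z : ℂ ⊗[ℝ] V) :
    ∃ a b : V, z = (1 : ℂ) ⊗ₜ[ℝ] a + Complex.I ⊗ₜ[ℝ] b := by
  induction z using TensorProduct.induction_on with
  | zero => exact ⟨0, 0, by simp⟩
  | tmul c v =>
    refine ⟨c.re • v, c.im • v, ?_⟩
    rw [TensorProduct.tmul_smul, TensorProduct.tmul_smul, TensorProduct.smul_tmul',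
      TensorProduct.smul_tmul', ← TensorProduct.add_tmul]
    congr 1
    apply Complex.ext <;> simp
  | add y z hy hz =>
    obtain ⟨a, b, rfl⟩ := hy
    obtain ⟨a', b', rfl⟩ := hz
    exact ⟨a + a', b + b', by rw [TensorProduct.tmul_add, TensorProduct.tmul_add]; abel⟩

theorem rid_baseChange_apply (l : V →ₗ[ℝ] ℝ) (a b : V) :
    TensorProduct.rid ℝ ℂ (l.baseChange ℂ ((1 : ℂ) ⊗ₜ[ℝ] a + Complex.I ⊗ₜ[ℝ] b)) =
      (l a : ℂ) + l b * Complex.I := by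
  rw [map_add, map_add, LinearMap.baseChange_tmul, LinearMap.baseChange_tmul,
    TensorProduct.rid_tmul, TensorProduct.rid_tmul, Complex.real_smul, Complex.real_smul, mul_one]

/-- In finite dimension a nondegenerate real form represents every functional; this is applied to
the real and the imaginary part of `L`, which give the two components of `z`. -/
theorem existsUnique_rid_baseChange [FiniteDimensional ℝ V] (β : V →ₗ[ℝ] V →ₗ[ℝ] ℝ)
    (hβ : ∀ v, (∀ w, β v w = 0) → v = 0) (L : V →ₗ[ℝ] ℂ) :
    ∃! z : ℂ ⊗[ℝ] V, ∀ w, TensorProduct.rid ℝ ℂ ((β.flip w).baseChange ℂ z) = L w := by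
  have hi : Function.Injective β := by
    rw [← LinearMap.ker_eq_bot, LinearMap.ker_eq_bot']
    exact fun v hv => hβ v fun w => by rw [hv, LinearMap.zero_apply]
  have hs : Function.Surjective β :=
    (LinearMap.injective_iff_surjective_of_finrank_eq_finrank
      (Subspace.dual_finrank_eq (K := ℝ) (V := V)).symm).1 hi
  obtain ⟨a, ha⟩ := hs (Complex.reLm ∘ₗ L)
  obtain ⟨b, hb⟩ := hs (Complex.imLm ∘ₗ L)
  refine ⟨(1 : ℂ) ⊗ₜ[ℝ] a + Complex.I ⊗ₜ[ℝ] b, fun w => ?_, fun z hz => ?_⟩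
  · rw [rid_baseChange_apply, LinearMap.flip_apply, LinearMap.flip_apply, ha, hb]
    exact Complex.re_add_im (L w)
  · obtain ⟨a', b', rfl⟩ := exists_eq_one_tmul_add_I_tmul z
    have h : ∀ w, β a' w = (L w).re ∧ β b' w = (L w).im := by
      intro w
      have := hz w
      rw [rid_baseChange_apply, LinearMap.flip_apply, LinearMap.flip_apply] at this
      rw [← this]
      simp
    have ea : a' = a := hi (by rw [ha]; exact LinearMap.ext fun w => (h w).1)
    have eb : b' = b := hi (by rw [hb]; exact LinearMap.ext fun w => (h w).2)
    rw [ea, eb]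

end ComplexTensor

/-! ### Functions with vanishing differential on a connected cotangent bundle -/

section LocallyConstant

open Filter Topology

/-- Read in a chart, `F` has zero derivative on a ball, which is convex. -/
theorem isLocallyConstant_of_mvfderiv_eq_zero {E N V : Type*} [NormedAddCommGroup E]
    [NormedSpace ℝ E] {H : Type*} [TopologicalSpace H] {J : ModelWithCorners ℝ E H}
    [J.Boundaryless] [TopologicalSpace N] [ChartedSpace H N] [IsManifold J 1 N]
    [NormedAddCommGroup V] [NormedSpace ℝ V]
    {F : N → V} (hF : MDifferentiable J 𝓘(ℝ, V) F) (h : ∀ p, mvfderiv J F p = 0) :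
    IsLocallyConstant F := by
  rw [IsLocallyConstant.iff_eventually_eq]
  intro p
  obtain ⟨ε, hε, hb⟩ := Metric.isOpen_iff.1 (isOpen_extChartAt_target (I := J) p) _
    (mem_extChartAt_target (I := J) p)
  have hd : ∀ z ∈ Metric.ball (extChartAt J p p) ε,
      HasFDerivAt (F ∘ (extChartAt J p).symm) (0 : E →L[ℝ] V) z := by
    intro z hz
    have d1 : MDifferentiableAt 𝓘(ℝ, E) J (extChartAt J p).symm z :=
      ((contMDiffOn_extChartAt_symm (n := 1) p).contMDiffAt
        ((isOpen_extChartAt_target p).mem_nhds (hb hz))).mdifferentiableAt (by simp)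
    have d2 := hF ((extChartAt J p).symm z)
    have e := mfderiv_comp z d2 d1
    have d3 : DifferentiableAt ℝ (F ∘ (extChartAt J p).symm) z :=
      mdifferentiableAt_iff_differentiableAt.1 (d2.comp z d1)
    rw [mfderiv_eq_fderiv] at e
    have e0 : fderiv ℝ (F ∘ (extChartAt J p).symm) z = 0 := by
      refine ContinuousLinearMap.ext fun v => ?_
      refine (congrArg (fun L => L v) e).trans ?_
      exact congrArg (fun L => L (mfderiv 𝓘(ℝ, E) J (extChartAt J p).symm z v))
        (h ((extChartAt J p).symm z))
    rw [← e0]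
    exact d3.hasFDerivAt
  filter_upwards [extChartAt_source_mem_nhds (I := J) p, (continuousAt_extChartAt (I := J)
    p).eventually (Metric.ball_mem_nhds _ hε)] with q hq1 hq2
  have := (convex_ball (extChartAt J p p) ε).is_const_of_fderivWithin_eq_zero
    (𝕜 := ℝ) (f := F ∘ (extChartAt J p).symm)
    (fun z hz => (hd z hz).differentiableAt.differentiableWithinAt)
    (fun z hz => ((hd z hz).hasFDerivWithinAt).fderivWithin
      (Metric.isOpen_ball.uniqueDiffWithinAt hz)) hq2 (Metric.mem_ball_self hε)
  rwa [Function.comp_apply, Function.comp_apply, (extChartAt J p).left_inv hq1,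
    extChartAt_to_inv] at this

variable {n : ℕ} {M : Type*} [TopologicalSpace M] [ChartedSpace (EuclideanSpace ℝ (Fin n)) M]
  [IsManifold (𝓡 n) ∞ M]

/-- Each covector is joined to zero by scaling in its fibre, and the zero section is a continuous
image of `M`. -/
theorem IsLocallyConstant.eq_of_cotangentBundle [PreconnectedSpace M] {Y : Type*}
    {F : CotangentBundle n M → Y} (hF : IsLocallyConstant F) (p q : CotangentBundle n M) :
    F p = F q := by
  have h1 : ∀ p : CotangentBundle n M, F p = F ⟨p.proj, 0⟩ := by
    intro p
    have hc : Continuous fun t : ℝ => (⟨p.proj, t • p.2⟩ : CotangentBundle n M) :=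
      (FiberBundle.continuous_totalSpaceMk (EuclideanSpace ℝ (Fin n) →L[ℝ] ℝ) (Cotangent n M)
        p.proj).comp (continuous_id.smul continuous_const)
    have := (hF.comp_continuous hc).apply_eq_of_isPreconnected isPreconnected_univ
      (Set.mem_univ 1) (Set.mem_univ 0)
    simpa using this
  have hz : Continuous fun x : M => (⟨x, 0⟩ : CotangentBundle n M) :=
    (Bundle.contMDiff_zeroSection (n := ∞) (IB := 𝓡 n) ℝ (Cotangent n M)).continuous
  rw [h1 p, h1 q]
  exact (hF.comp_continuous hz).apply_eq_of_isPreconnected isPreconnected_univ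
    (Set.mem_univ p.proj) (Set.mem_univ q.proj)

end LocallyConstant

/-! ### Existence and uniqueness of Hamiltonian fields -/

section HamiltonianField

variable {n : ℕ} {M : Type*} [TopologicalSpace M] [ChartedSpace (EuclideanSpace ℝ (Fin n)) M]
  [IsManifold (𝓡 n) ∞ M]

theorem symplecticForm_nondegenerate (p : CotangentBundle n M)
    (v : TangentSpace (cotangentModel n) p) (h : ∀ w, symplecticForm p v w = 0) : v = 0 := by
  let v' : CotangentModel n := v
  have h' : ∀ w : CotangentModel n, v'.2 w.1 - w.2 v'.1 = 0 := fun w =>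
    (symplecticForm_apply p v' w).symm.trans (h w)
  have h2 : v'.2 = 0 := ContinuousLinearMap.ext fun u => by simpa using h' (u, 0)
  have h1 : v'.1 = 0 := by
    ext i
    simpa using h' (0, EuclideanSpace.proj i)
  exact Prod.ext h1 h2

/-- Linear algebra at each point: `mvfderiv` is a linear form even where `F` is not differentiable,
so `F` may be arbitrary. -/
theorem existsUnique_isHamiltonianField (F : CotangentBundle n M → ℂ) :
    ∃! D : ComplexField n M, IsHamiltonianField F D := by
  have hV : ∀ p : CotangentBundle n M, FiniteDimensional ℝ (TangentSpace (cotangentModel n) p) :=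
    fun p => inferInstanceAs (FiniteDimensional ℝ (CotangentModel n))
  have h := fun p : CotangentBundle n M => existsUnique_rid_baseChange (symplecticForm p)
    (symplecticForm_nondegenerate p) (-(mvfderiv (cotangentModel n) F p).toLinearMap)
  choose D hD hD' using h
  refine ⟨D, fun p w => ?_, fun D' h' => funext fun p => hD' p (D' p) fun w => ?_⟩
  · exact (congrArg (· + mvfderiv (cotangentModel n) F p w) (hD p w)).trans (neg_add_cancel _)
  · exact eq_neg_of_add_eq_zero_left (h' p w)

/-- On a connected manifold, two functions on the cotangent bundle have the same Hamiltonian field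
if and only if they differ by a constant. -/
theorem IsHamiltonianField.iff_of_isHamiltonianField [PreconnectedSpace M]
    {F G : CotangentBundle n M → ℂ} (hF : ContMDiff (cotangentModel n) 𝓘(ℝ, ℂ) ∞ F)
    (hG : ContMDiff (cotangentModel n) 𝓘(ℝ, ℂ) ∞ G) {D : ComplexField n M}
    (hD : IsHamiltonianField F D) :
    IsHamiltonianField G D ↔ ∃ c : ℂ, ∀ p, F p - G p = c := by
  have hF' : MDifferentiable (cotangentModel n) 𝓘(ℝ, ℂ) F := hF.mdifferentiable (by simp)
  have hG' : MDifferentiable (cotangentModel n) 𝓘(ℝ, ℂ) G := hG.mdifferentiable (by simp)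
  have hs : ∀ p, mvfderiv (cotangentModel n) (F - G) p =
      mvfderiv (cotangentModel n) F p - mvfderiv (cotangentModel n) G p := fun p =>
    mvfderiv_sub (hF' p) (hG' p)
  constructor
  · intro h
    have hlc : IsLocallyConstant (F - G) := by
      refine isLocallyConstant_of_mvfderiv_eq_zero (J := cotangentModel n) (hF'.sub hG') fun p => ?_
      rw [hs, sub_eq_zero]
      exact ContinuousLinearMap.ext fun w => add_left_cancel ((hD p w).trans (h p w).symm)
    by_cases hN : Nonempty (CotangentBundle n M)
    · obtain ⟨q⟩ := hN
      exact ⟨F q - G q, fun p => IsLocallyConstant.eq_of_cotangentBundle hlc p q⟩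
    · exact ⟨0, fun p => absurd ⟨p⟩ hN⟩
  · rintro ⟨c, hc⟩ p w
    have e : F - G = fun _ => c := funext hc
    have h0 := hs p
    rw [e, mvfderiv_const] at h0
    rw [← sub_eq_zero.1 h0.symm]
    exact hD p w

end HamiltonianField

/-! ### Differential operators modulo constants and Hamiltonian fields -/

section Correspondence

variable {n : ℕ} {M : Type*} [TopologicalSpace M] [T2Space M]
  [ChartedSpace (EuclideanSpace ℝ (Fin n)) M] [IsManifold (𝓡 n) ∞ M]

theorem mem_constantOp_iff (P : diffOp n M) :
    P ∈ constantOp n M ↔ ∃ c : ℂ, P.1 = c • LinearMap.id :=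
  Submodule.mem_span_singleton.trans ⟨fun ⟨c, hc⟩ => ⟨c, hc.symm⟩, fun ⟨c, hc⟩ => ⟨c, hc.symm⟩⟩

variable (cov : LinearConnection n M) [cov.ContMDiffCovariantDerivative ∞] {ħ : ℝ} (hħ : ħ ≠ 0)

include hħ

theorem existsUnique_isAssociatedField (P : diffOp n M) :
    ∃! D : polynomialHamiltonianFields n M, IsAssociatedField ħ cov P.1 D.1 := by
  obtain ⟨Φ, hΦ, hu⟩ := existsUnique_isQuantized cov ħ hħ P
  obtain ⟨D, hD, hD'⟩ := existsUnique_isHamiltonianField (fibreFunction Φ)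
  refine ⟨⟨D, fibreFunction Φ, isFibrePolynomial_fibreFunction Φ, hD⟩, ⟨Φ, hΦ, hD⟩, ?_⟩
  rintro D' ⟨Ψ, hΨ, h⟩
  rw [hu Ψ hΨ] at h
  exact Subtype.ext (hD' _ h)

/-- The Hamiltonian field associated with a differential operator. -/
def associatedField (P : diffOp n M) : polynomialHamiltonianFields n M :=
  (existsUnique_isAssociatedField cov hħ P).choose

theorem associatedField_eq_iff (P : diffOp n M) (D : polynomialHamiltonianFields n M) :
    associatedField cov hħ P = D ↔ IsAssociatedField ħ cov P.1 D.1 := by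
  have h := (existsUnique_isAssociatedField cov hħ P).choose_spec
  exact ⟨fun e => e ▸ h.1, fun hD => (h.2 D hD).symm⟩

theorem associatedField_surjective : Function.Surjective (associatedField (M := M) cov hħ) := by
  rintro ⟨D, F, hF, hD⟩
  obtain ⟨Φ, rfl⟩ := exists_fibreFunction_eq hF
  exact ⟨⟨quantize cov ħ Φ, quantize_mem_diffOp cov ħ Φ⟩, (associatedField_eq_iff cov hħ _ _).2
    ⟨Φ, (isQuantized_iff cov ħ Φ _).2 rfl, hD⟩⟩

/-- Equal fields mean that the two functions differ by a constant, which through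
`fibreFunction_sub_eq_const_iff` says that the operators differ by a multiple of the identity. -/
theorem associatedField_eq_associatedField_iff [PreconnectedSpace M] (P Q : diffOp n M) :
    associatedField cov hħ P = associatedField cov hħ Q ↔ P - Q ∈ constantOp n M := by
  obtain ⟨Φ, hΦ, hD⟩ := (associatedField_eq_iff cov hħ P _).1 rfl
  obtain ⟨Ψ, hΨ, hu⟩ := existsUnique_isQuantized cov ħ hħ Q
  have e : (P - Q).1 = quantize cov ħ Φ - quantize cov ħ Ψ := by
    rw [← (isQuantized_iff cov ħ Φ P.1).1 hΦ, ← (isQuantized_iff cov ħ Ψ Q.1).1 hΨ]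
    rfl
  rw [eq_comm, associatedField_eq_iff, mem_constantOp_iff, e]
  simp only [← fibreFunction_sub_eq_const_iff cov hħ]
  rw [← IsHamiltonianField.iff_of_isHamiltonianField (isFibrePolynomial_fibreFunction Φ).1
    (isFibrePolynomial_fibreFunction Ψ).1 hD]
  refine ⟨?_, fun h => ⟨Ψ, hΨ, h⟩⟩
  rintro ⟨Θ, hΘ, h⟩
  rwa [hu Θ hΘ] at h

/-- The bijection between differential operators modulo constants and infinitesimal canonical
transformations. -/
def quotientEquiv [PreconnectedSpace M] :
    (diffOp n M ⧸ constantOp n M) ≃ polynomialHamiltonianFields n M :=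
  Equiv.ofBijective
    (Quotient.lift (s := (constantOp n M).quotientRel) (associatedField cov hħ) fun P Q h =>
      (associatedField_eq_associatedField_iff cov hħ P Q).2 (Submodule.quotientRel_def _ |>.1 h))
    ⟨by
      rintro ⟨P⟩ ⟨Q⟩ h
      exact (Submodule.Quotient.eq _).2 ((associatedField_eq_associatedField_iff cov hħ P Q).1 h),
    fun D => by
      obtain ⟨P, rfl⟩ := associatedField_surjective cov hħ D
      exact ⟨Submodule.Quotient.mk P, rfl⟩⟩

theorem quotientEquiv_mk [PreconnectedSpace M] (P : diffOp n M) :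
    quotientEquiv cov hħ (Submodule.Quotient.mk P) = associatedField cov hħ P := rfl

end Correspondence

end Quantization

end

theorem mainTheorem3 (n : ℕ) (M : Type*) [TopologicalSpace M] [T2Space M] [ConnectedSpace M]
    [ChartedSpace (EuclideanSpace ℝ (Fin n)) M] [IsManifold (𝓡 n) ∞ M]
    (cov : Quantization.LinearConnection n M) [cov.ContMDiffCovariantDerivative ∞]
    (hcov : cov.torsion = 0) (ħ : ℝ) (hħ : ħ ≠ 0) :
    (∀ P : Quantization.diffOp n M,
      ∃! Φ : Quantization.SymTensor n M, Quantization.IsQuantized ħ cov Φ P.1) ∧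
    ∃ e : (Quantization.diffOp n M ⧸ Quantization.constantOp n M) ≃
        Quantization.polynomialHamiltonianFields n M,
      ∀ (P : Quantization.diffOp n M) (D : Quantization.polynomialHamiltonianFields n M),
        e (Submodule.Quotient.mk P) = D ↔ Quantization.IsAssociatedField ħ cov P.1 D.1 := by
  refine ⟨fun P => Quantization.existsUnique_isQuantized cov ħ hħ P,
    Quantization.quotientEquiv cov hħ, fun P D => ?_⟩
  rw [Quantization.quotientEquiv_mk]
  exact Quantization.associatedField_eq_iff cov hħ P D
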